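/- **Setting.** Let $A$ be a set of $K\ge 1$ actions and $T$ a number of rounds. In each round $t\in[T]$ one of $T$ agents arrives, a recommendation algorithm draws a recommendation $I_t\in A$ (possibly depending on what it recorded in earlier rounds), the agent plays an action $a_t\in A$, and the algorithm observes $a_t$ and the reward $u_{t,a_t}$ of the played action, where $u_t\in[0,1]^K$ is the reward vector of the round. A strategy of an agent is a map $\sigma:A\to A$ from recommendations to actions; the compliant strategy is the identity, and $\sigma^*$ is the profile of compliant strategies. *Beliefs.* Agent $i\in[T]$ believes that a sequence $\mu=(\mu_1,\dots,\mu_T)$ of mean vectors $\mu_t\in[0,1]^K$ is drawn from a distribution $\mathcal P^i$; that given $\mu$ the reward vectors $u_1,\dots,u_T\in[0,1]^K$ are independent over rounds with $\mathbb E[u_{t,a}\mid\mu]=\mu_{t,a}$; and that, independently of $(\mu,u)$, the arrival times $\tau=(\tau_1,\dots,\tau_T)$ are drawn from a distribution on permutations of $[T]$ (agent $j$ arrives in round $\tau_j$). Her temporal belief $\mathcal D^i$ is the marginal law of $\tau_i$. Let $\mathrm{gap}_{\mu,\mathcal D}(a)=\min_{b\ne a}\mathbb E_{t\sim\mathcal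 D}[\mu_{t,a}-\mu_{t,b}]$ (with $\min\emptyset=+\infty$). *Equilibrium.* An algorithm implements an incentive-compatible Bayes $\epsilon$-Nash equilibrium, with error $\epsilon_i\in[0,+\infty]$ for agent $i$, if for every $i$, every $\sigma_i':A\to A$ and every $a\in A$ with $\Pr(I_{\tau_i}=a\mid\sigma^*)>0$ under agent $i$'s belief, $$\mathbb E[\mu_{\tau_i,I_{\tau_i}}\mid I_{\tau_i}=a,\sigma^*_{-i}]\ \ge\ \mathbb E[\mu_{\tau_i,\sigma_i'(I_{\tau_i})}\mid I_{\tau_i}=a,\sigma^*_{-i}]-\epsilon_i .$$ *Exp4.S with parameter $L_0$.* Put $\eta=\sqrt{\ln(KL_0)/(KL_0)}$ and $\gamma=1/(KL_0)$. Start with $p_1$ uniform on $A$. In round $t$ draw $I_t\sim p_t$; after observing $a_t$ and $r_t=u_{t,a_t}$, put $\hat\ell_t(b)=\frac{1-r_t}{p_t(b)}\mathbf 1[b=a_t]$, $\tilde p_{t+1}(b)=p_t(b)e^{-\eta\hat\ell_t(b)}\big/\sum_c p_t(c)e^{-\eta\hat\ell_t(c)}$, and $p_{t+1}(b)=(1-K\gamma)\,\tilde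 p_{t+1}(b)+\gamma$. **Theorem.** There is an absolute constant $C>0$ with the following two properties. (1) Let $T,K\ge1$, $\alpha,\Delta>0$, $\rho\in\mathbb R$, and consider agents $i\in[T]$ with beliefs as above such that for all $i$: (a) $\Pr_{\mu\sim\mathcal P^i}(\mathrm{gap}_{\mu,\mathcal D^i}(a)\ge\Delta)\ge\alpha$ for every $a\in A$; (b) $\mathcal P^i$-almost surely, $\|\mu_{t+1}-\mu_t\|_\infty\le\rho$ for all $t\in[T-1]$; (c) $\mathcal D^i$ is uniform on some interval of $L_i\ge1$ consecutive rounds in $[T]$. Then Exp4.S with parameter $T$ implements an incentive-compatible Bayes $\epsilon$-Nash equilibrium with error $\epsilon_i=\epsilon(T,K,\alpha,\Delta,\rho,L_i)$ for agent $i$, where $$\epsilon(T,K,\alpha,\Delta,\rho,L)=\frac{\left(\frac{C\sqrt{TK\ln(TK)}}{L}+\frac{2\rho(L^2-1)}{3L}+2\sqrt{\frac{2\ln(2K)}{L}}\right)\bigl(\Delta-\rho(L-1)\bigr)}{\alpha\left(\Delta-\frac{C\sqrt{TK\ln(TK)}}{L}-\rho(L-1)-2\sqrt{\frac{2\ln(2K)}{L}}\right)}$$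 if the denominator is positive, and $\epsilon(T,K,\alpha,\Delta,\rho,L)=+\infty$ otherwise. (2) For fixed $K\ge1$ and $\alpha,\Delta>0$, and for all sequences $L=L(T)\in\mathbb N$ and $\rho=\rho(T)\in\mathbb R$ with $\sqrt{T\ln T}=o(L(T))$ and $\rho(T)=o(1/L(T))$ as $T\to\infty$, we have $\epsilon(T,K,\alpha,\Delta,\rho(T),L(T))\to0$. -/

import Mathlib

open MeasureTheory ProbabilityTheory Filter Topology Asymptotics

noncomputable section

/-- A sequence of vectors indexed by rounds `t` and actions `a`. It is used both for the sequences
of mean reward vectors `μ` and for the sequences of realized reward vectors `u`. -/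
abbrev RewardSeq (T K : ℕ) : Type := Fin T → Fin K → ℝ

/-- What the algorithm records about one round: the recommendation `I`, the action `a` that was
actually played, and the observed (bandit) reward `u a` of the played action. -/
abbrev RoundRecord (K : ℕ) : Type := Fin K × Fin K × ℝ

/-- A randomized recommendation algorithm for `K` actions: after `n` rounds with records `h`, the
next recommendation is drawn from the distribution `prob n h` on the actions. -/
structure BanditAlgorithm (K : ℕ) where
  prob : (n : ℕ) → (Fin n → RoundRecord K) → Fin K → ℝ
  prob_nonneg : ∀ n h a, 0 ≤ prob n h a
  prob_sum : ∀ n h, ∑ a, prob n h a = 1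
  prob_measurable : ∀ n a, Measurable (fun h => prob n h a)

/-! ### The algorithm Exp4.S

Exponential weights on importance-weighted losses `1 - reward`, with a fixed share of uniform
mass mixed in after each update; the experts are the `K` actions. The parameter `L` is the largest
interval length of interest: the learning rate is `√(ln (KL) / (KL))`, the share is `1 / (KL)`. -/

/-- Learning rate of Exp4.S with parameter `L`. -/
def exp4sRate (K L : ℕ) : ℝ := √(Real.log ((K : ℝ) * L) / ((K : ℝ) * L))

/-- Mass that Exp4.S with parameter `L` mixes into each action after each round. -/
def exp4sShare (K L : ℕ) : ℝ := 1 / ((K : ℝ) * L)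

/-- Importance-weighted estimate of the loss `1 - reward` of the action `b`, when the action
distribution of the round was `p`, action `a` was played and reward `r` was observed. -/
def exp4sLossEst {K : ℕ} (p : Fin K → ℝ) (a : Fin K) (r : ℝ) (b : Fin K) : ℝ :=
  if b = a then (1 - r) / p b else 0

/-- One update of the action distribution of Exp4.S. -/
def exp4sUpdate {K : ℕ} (L : ℕ) (p : Fin K → ℝ) (a : Fin K) (r : ℝ) (b : Fin K) : ℝ :=
  (1 - K * exp4sShare K L) *
      (p b * Real.exp (-exp4sRate K L * exp4sLossEst p a r b) /
        ∑ c, p c * Real.exp (-exp4sRate K L * exp4sLossEst p a r c)) +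
    exp4sShare K L

/-- The action distribution of Exp4.S with parameter `L` after `n` rounds. -/
def exp4sProb (K L : ℕ) : (n : ℕ) → (Fin n → RoundRecord K) → Fin K → ℝ
  | 0, _ => fun _ => 1 / (K : ℝ)
  | n + 1, h =>
      exp4sUpdate L (exp4sProb K L n (fun s => h s.castSucc)) (h (Fin.last n)).2.1
        (h (Fin.last n)).2.2

lemma exp4sShare_nonneg (K L : ℕ) : 0 ≤ exp4sShare K L := by
  unfold exp4sShare; positivity

lemma mul_exp4sShare_le_one (K L : ℕ) : (K : ℝ) * exp4sShare K L ≤ 1 := by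
  unfold exp4sShare
  rcases Nat.eq_zero_or_pos K with rfl | hK
  · simp
  rcases Nat.eq_zero_or_pos L with rfl | hL
  · simp
  have hK' : (0 : ℝ) < K := by exact_mod_cast hK
  have hL' : (1 : ℝ) ≤ L := by exact_mod_cast hL
  rw [mul_one_div, div_le_one (by positivity)]
  nlinarith

lemma exp4sProb_nonneg_sum (K L : ℕ) [NeZero K] (n : ℕ) (h : Fin n → RoundRecord K) :
    (∀ a, 0 ≤ exp4sProb K L n h a) ∧ ∑ a, exp4sProb K L n h a = 1 := by
  have hK : (K : ℝ) ≠ 0 := by exact_mod_cast NeZero.ne K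
  induction n with
  | zero =>
    refine ⟨fun a => ?_, ?_⟩
    · simp only [exp4sProb]; positivity
    · simp [exp4sProb, hK]
  | succ n ih =>
    obtain ⟨hp, hs⟩ := ih (fun s => h s.castSucc)
    simp only [exp4sProb]
    set p := exp4sProb K L n (fun s => h s.castSucc) with hpdef
    set a := (h (Fin.last n)).2.1
    set r := (h (Fin.last n)).2.2
    have hZ : 0 < ∑ c, p c * Real.exp (-exp4sRate K L * exp4sLossEst p a r c) := by
      obtain ⟨c, -, hc⟩ : ∃ c ∈ Finset.univ, 0 < p c := by
        apply Finset.exists_lt_of_sum_lt (f := fun _ => (0 : ℝ))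
        simp [hs]
      exact Finset.sum_pos' (fun c _ => mul_nonneg (hp c) (Real.exp_pos _).le)
        ⟨c, Finset.mem_univ c, mul_pos hc (Real.exp_pos _)⟩
    refine ⟨fun b => ?_, ?_⟩
    · unfold exp4sUpdate
      have h1 := mul_exp4sShare_le_one K L
      exact add_nonneg (mul_nonneg (by linarith)
        (div_nonneg (mul_nonneg (hp b) (Real.exp_pos _).le) hZ.le)) (exp4sShare_nonneg K L)
    · unfold exp4sUpdate
      rw [Finset.sum_add_distrib, ← Finset.mul_sum, ← Finset.sum_div, div_self hZ.ne']
      simp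

lemma exp4sProb_measurable (K L : ℕ) (n : ℕ) (a : Fin K) :
    Measurable (fun h : Fin n → RoundRecord K => exp4sProb K L n h a) := by
  induction n generalizing a with
  | zero => simp only [exp4sProb]; exact measurable_const
  | succ n ih =>
    have hp : ∀ b, Measurable (fun h : Fin (n + 1) → RoundRecord K =>
        exp4sProb K L n (fun s => h s.castSucc) b) := fun b =>
      (ih b).comp (measurable_pi_lambda _ fun s => measurable_pi_apply _)
    have ha : Measurable (fun h : Fin (n + 1) → RoundRecord K => (h (Fin.last n)).2.1) :=
      (measurable_pi_apply (Fin.last n)).snd.fst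
    have hr : Measurable (fun h : Fin (n + 1) → RoundRecord K => (h (Fin.last n)).2.2) :=
      (measurable_pi_apply (Fin.last n)).snd.snd
    have hl : ∀ b, Measurable (fun h : Fin (n + 1) → RoundRecord K =>
        exp4sLossEst (exp4sProb K L n (fun s => h s.castSucc)) (h (Fin.last n)).2.1
          (h (Fin.last n)).2.2 b) := fun b => by
      unfold exp4sLossEst
      refine Measurable.ite ?_ ((measurable_const.sub hr).div (hp b)) measurable_const
      exact measurableSet_eq_fun measurable_const ha
    have hw : ∀ b, Measurable (fun h : Fin (n + 1) → RoundRecord K =>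
        exp4sProb K L n (fun s => h s.castSucc) b *
          Real.exp (-exp4sRate K L * exp4sLossEst (exp4sProb K L n (fun s => h s.castSucc))
            (h (Fin.last n)).2.1 (h (Fin.last n)).2.2 b)) := fun b =>
      (hp b).mul (Real.measurable_exp.comp ((hl b).const_mul _))
    simp only [exp4sProb, exp4sUpdate]
    exact (((hw a).div (Finset.measurable_sum _ fun c _ => hw c)).const_mul _).add_const _

/-- Exp4.S with parameter `L` for `K` actions. -/
def exp4S (K L : ℕ) [NeZero K] : BanditAlgorithm K where
  prob := exp4sProb K L
  prob_nonneg n h := (exp4sProb_nonneg_sum K L n h).1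
  prob_sum n h := (exp4sProb_nonneg_sum K L n h).2
  prob_measurable := exp4sProb_measurable K L

/-! ### Beliefs -/

/-- The beliefs of one agent: a reward belief (a prior over sequences of mean reward vectors,
together with the conditional law of the realized rewards given the means), and a full arrival
belief, independent of it. Given `μ`, the reward vectors of distinct rounds are independent, lie in
`[0,1]^K`, and have mean `μ`. In a profile `τ` of arrival times, agent `i` arrives in round `τ i`. -/
structure Belief (T K : ℕ) where
  prior : Measure (RewardSeq T K)
  prior_prob : IsProbabilityMeasure prior
  prior_mem : ∀ᵐ μ ∂prior, ∀ t a, μ t a ∈ Set.Icc (0 : ℝ) 1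
  law : Kernel (RewardSeq T K) (RewardSeq T K)
  law_markov : IsMarkovKernel law
  law_mem : ∀ᵐ μ ∂prior, ∀ᵐ u ∂(law μ), ∀ t a, u t a ∈ Set.Icc (0 : ℝ) 1
  law_indep : ∀ᵐ μ ∂prior, iIndepFun (fun (t : Fin T) (u : RewardSeq T K) => u t) (law μ)
  law_mean : ∀ᵐ μ ∂prior, ∀ t a, ∫ u, u t a ∂(law μ) = μ t a
  arrival : PMF (Equiv.Perm (Fin T))

/-- The temporal belief of agent `i`: the marginal distribution of `τ i`. -/
def Belief.temporal {T K : ℕ} (B : Belief T K) (i : Fin T) (t : Fin T) : ℝ :=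
  ((B.arrival.map (fun τ => τ i)) t).toReal

/-- The uniform distribution on the `L` consecutive rounds `s, …, s + L - 1` (rounds are numbered
from `0`). -/
def uniformInterval (T s L : ℕ) (t : Fin T) : ℝ :=
  if s ≤ (t : ℕ) ∧ (t : ℕ) < s + L then 1 / (L : ℝ) else 0

/-- `gap_{μ,D}(a) = min_{b ≠ a} E_{t ∼ D}[μ_{t,a} - μ_{t,b}]`, which is `⊤` if there is no `b ≠ a`. -/
def gap {T K : ℕ} (μ : RewardSeq T K) (D : Fin T → ℝ) (a : Fin K) : EReal :=
  (Finset.univ.erase a).inf (fun b => ((∑ t, D t * (μ t a - μ t b) : ℝ) : EReal))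

/-- Each action has probability at least `α` of outperforming every other action by at least `Δ`
on average over the temporal belief `D`. -/
def Explorable {T K : ℕ} (P : Measure (RewardSeq T K)) (D : Fin T → ℝ) (α Δ : ℝ) : Prop :=
  ∀ a, α ≤ P.real {μ | (Δ : EReal) ≤ gap μ D a}

/-- Almost surely, the mean reward vectors move by at most `ρ` in the sup norm (the norm of
`Fin K → ℝ`) from each round to the next. -/
def SlowlyMoving {T K : ℕ} (P : Measure (RewardSeq T K)) (ρ : ℝ) : Prop :=
  ∀ᵐ μ ∂P, ∀ (t : ℕ) (h : t + 1 < T), ‖μ ⟨t + 1, h⟩ - μ ⟨t, by omega⟩‖ ≤ ρ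

/-! ### The recommendation game -/

/-- A profile of strategies; agent `i` plays action `σ i a` when recommended `a`. -/
abbrev Profile (T K : ℕ) : Type := Fin T → Fin K → Fin K

/-- The profile in which each agent follows the recommendation. -/
def compliant (T K : ℕ) : Profile T K := fun _ a => a

/-- The record of round `t`, when recommendations are `I`, rewards are `u`, and the agent
`τ.symm t` who arrives in round `t` plays according to `σ`. -/
def roundRecord {T K : ℕ} (σ : Profile T K) (τ : Equiv.Perm (Fin T)) (u : RewardSeq T K)
    (I : Fin T → Fin K) (t : Fin T) : RoundRecord K :=
  (I t, σ (τ.symm t) (I t), u t (σ (τ.symm t) (I t)))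

/-- Probability that `A` issues the recommendations `I` over the `T` rounds, given the arrival
profile `τ` and the rewards `u`, when agents play `σ`. -/
def pathProb {T K : ℕ} (A : BanditAlgorithm K) (σ : Profile T K) (τ : Equiv.Perm (Fin T))
    (u : RewardSeq T K) (I : Fin T → Fin K) : ℝ :=
  ∏ t : Fin T, A.prob t (fun s : Fin t => roundRecord σ τ u I ⟨s, s.2.trans t.2⟩) (I t)

/-- Expectation of `f τ μ I` under the belief `B`, for play of `A` with profile `σ`: the arrival
profile `τ` is drawn from the arrival belief, independently the means `μ` from the prior and the
rewards `u` from their law given `μ`, and the recommendations `I` are generated by `A`. -/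
def expect {T K : ℕ} (A : BanditAlgorithm K) (σ : Profile T K) (B : Belief T K)
    (f : Equiv.Perm (Fin T) → RewardSeq T K → (Fin T → Fin K) → ℝ) : ℝ :=
  ∑ τ : Equiv.Perm (Fin T), (B.arrival τ).toReal *
    ∫ x : RewardSeq T K × RewardSeq T K,
      ∑ I : Fin T → Fin K, pathProb A σ τ x.2 I * f τ x.1 I ∂(B.prior ⊗ₘ B.law)

/-- Probability that agent `i` with belief `B` assigns to being recommended `a`. -/
def recProb {T K : ℕ} (A : BanditAlgorithm K) (σ : Profile T K) (B : Belief T K) (i : Fin T)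
    (a : Fin K) : ℝ :=
  expect A σ B (fun τ _ I => if I (τ i) = a then 1 else 0)

/-- Expected payoff of agent `i` with belief `B` under the profile `σ`, conditional on being
recommended `a`. -/
def condPayoff {T K : ℕ} (A : BanditAlgorithm K) (σ : Profile T K) (B : Belief T K) (i : Fin T)
    (a : Fin K) : ℝ :=
  expect A σ B (fun τ μ I => if I (τ i) = a then μ (τ i) (σ i (I (τ i))) else 0) /
    recProb A σ B i a

/-- `A` implements an incentive-compatible Bayes `ε`-Nash equilibrium for agents with beliefs `B`:
for each agent `i` and each recommendation `a` that she believes to have positive probability, no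
unilateral deviation from compliance gains more than `ε i` in expectation conditional on `a`. -/
def IsICBayesNash {T K : ℕ} (A : BanditAlgorithm K) (B : Fin T → Belief T K)
    (ε : Fin T → EReal) : Prop :=
  ∀ (i : Fin T) (σ' : Fin K → Fin K) (a : Fin K), 0 < recProb A (compliant T K) (B i) i a →
    (condPayoff A (Function.update (compliant T K) i σ') (B i) i a : EReal) - ε i ≤
      (condPayoff A (compliant T K) (B i) i a : EReal)

/-! ### The error term -/

/-- The regret term `C √(TK ln(TK)) / L`. -/
def regretTerm (C : ℝ) (T K L : ℕ) : ℝ :=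
  C * √((T : ℝ) * K * Real.log ((T : ℝ) * K)) / L

/-- The concentration term `2 √(2 ln(2K) / L)`. -/
def concTerm (K L : ℕ) : ℝ := 2 * √(2 * Real.log (2 * (K : ℝ)) / L)

/-- The error of an agent whose temporal belief is uniform over `L` consecutive rounds; it is `+∞`
unless the effective gap in the denominator is positive. -/
def uniformError (C : ℝ) (T K : ℕ) (α Δ ρ : ℝ) (L : ℕ) : EReal :=
  if 0 < Δ - regretTerm C T K L - ρ * ((L : ℝ) - 1) - concTerm K L then
    (((regretTerm C T K L + 2 * ρ * ((L : ℝ) ^ 2 - 1) / (3 * L) + concTerm K L) *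
        (Δ - ρ * ((L : ℝ) - 1)) /
      (α * (Δ - regretTerm C T K L - ρ * ((L : ℝ) - 1) - concTerm K L)) : ℝ) : EReal)
  else ⊤

end

/-! Incentives rest on two facts: Exp4.S has small expected regret on every interval, and a
recommendation depends only on earlier rounds.

The regret bound (`exp4S_interval_regret`) uses the expected potential log p(e). Each round raises
it by at least η times the regret against e, minus a second-moment term and the cost 2/T of the
uniform share. The potential is at most 0, and the share keeps it above -log(KT) wherever the
interval starts; hence the bound holds on all intervals and not only on those starting in the first
round.

Because recommendations look only at the past, a deviation by an agent leaves the law of her own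
recommendation unchanged (`sum_pathProb_update_mul`). Given the means, the reward of a round is
independent of its recommendation, so regret in realized rewards becomes regret in means for almost
every μ (`ae_interval_regret`).

With a uniform temporal belief, the conditional gain from replacing a by b is a ratio of sums over
the interval. Its numerator is at most the regret against the best action of each round, that is,
external regret plus drift (`swap_gain_le`). Its denominator is the probability of being recommended
a. On the event gap ≥ Δ, action a leads by Δ - ρ(L-1) in every round, so low regret forces a to be
recommended most of the time, and Markov's inequality together with explorability bounds the
denominator below (`le_recProb`). All bounds are in expectation, so no concentration is needed: the
concentration term in the error is slack. The error vanishes because its numerator tends to 0 while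
its denominator tends to αΔ. -/

noncomputable section

/-! ### Marginals of the law of the recommendations -/

section Path

variable {K : ℕ} (A : BanditAlgorithm K) (R : ℕ → Fin K → RoundRecord K)

/-- Distribution of the recommendation of round `n`, given the recommendations `J` of the earlier
rounds, when recommendation `c` in round `s` leads to the record `R s c`. -/
def nextProb (n : ℕ) (J : Fin n → Fin K) (a : Fin K) : ℝ :=
  A.prob n (fun s => R s (J s)) a

/-- Probability of the recommendations `J` in the first `n` rounds. -/
def pathWeight (n : ℕ) (J : Fin n → Fin K) : ℝ :=
  ∏ t : Fin n, nextProb A R t (fun s => J ⟨s, s.2.trans t.2⟩) (J t)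

/-- Expectation of a function of the recommendations of the first `n` rounds. -/
def pathExp (n : ℕ) (f : (Fin n → Fin K) → ℝ) : ℝ :=
  ∑ J, pathWeight A R n J * f J

/-- Probability of being recommended `a` in round `n`. -/
def recMarginal (n : ℕ) (a : Fin K) : ℝ :=
  pathExp A R n fun J => nextProb A R n J a

lemma nextProb_nonneg (n : ℕ) (J : Fin n → Fin K) (a : Fin K) : 0 ≤ nextProb A R n J a :=
  A.prob_nonneg _ _ _

lemma sum_nextProb (n : ℕ) (J : Fin n → Fin K) : ∑ a, nextProb A R n J a = 1 :=
  A.prob_sum _ _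

lemma pathWeight_nonneg (n : ℕ) (J : Fin n → Fin K) : 0 ≤ pathWeight A R n J :=
  Finset.prod_nonneg fun _ _ => nextProb_nonneg _ _ _ _ _

lemma pathWeight_snoc (n : ℕ) (J : Fin n → Fin K) (a : Fin K) :
    pathWeight A R (n + 1) (Fin.snoc (α := fun _ => Fin K) J a) =
      pathWeight A R n J * nextProb A R n J a := by
  unfold pathWeight
  rw [Fin.prod_univ_castSucc]
  congr 1
  · refine Finset.prod_congr rfl fun t _ => ?_
    simp only [Fin.snoc_castSucc, Fin.val_castSucc]
    congr 1
    funext s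
    exact Fin.snoc_castSucc (α := fun _ => Fin K) a J ⟨s, s.2.trans t.2⟩
  · simp only [Fin.snoc_last, Fin.val_last]
    congr 1
    funext s
    exact Fin.snoc_castSucc (α := fun _ => Fin K) a J s

lemma sum_fin_succ_pi {n : ℕ} (f : (Fin (n + 1) → Fin K) → ℝ) :
    ∑ I, f I = ∑ J : Fin n → Fin K, ∑ a, f (Fin.snoc (α := fun _ => Fin K) J a) := by
  rw [← (Fin.snocEquiv (fun _ : Fin (n + 1) => Fin K)).sum_comp, Fintype.sum_prod_type_right]
  rfl

lemma pathExp_succ (n : ℕ) (f : (Fin (n + 1) → Fin K) → ℝ) :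
    pathExp A R (n + 1) f = pathExp A R n fun J =>
      ∑ a, nextProb A R n J a * f (Fin.snoc (α := fun _ => Fin K) J a) := by
  unfold pathExp
  rw [sum_fin_succ_pi]
  refine Finset.sum_congr rfl fun J _ => ?_
  rw [Finset.mul_sum]
  refine Finset.sum_congr rfl fun a _ => ?_
  rw [pathWeight_snoc, mul_assoc]

/-- Later rounds can be summed out one at a time, since each next-step distribution has total mass
one. -/
lemma pathExp_take {m n : ℕ} (h : m ≤ n) (f : (Fin m → Fin K) → ℝ) :
    pathExp A R n (fun I => f fun s => I (Fin.castLE h s)) = pathExp A R m f := by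
  induction n, h using Nat.le_induction with
  | base => rfl
  | succ n h ih =>
    rw [pathExp_succ, ← ih]
    congr 1
    funext J
    have : ∀ a, (fun s => (Fin.snoc (α := fun _ => Fin K) J a : Fin (n + 1) → Fin K)
        (Fin.castLE (Nat.le_succ_of_le h) s)) = fun s => J (Fin.castLE h s) := fun a => by
      funext s
      exact Fin.snoc_castSucc (α := fun _ => Fin K) a J (Fin.castLE h s)
    simp only [this, ← Finset.sum_mul, sum_nextProb, one_mul]

lemma pathExp_const (n : ℕ) (c : ℝ) : pathExp A R n (fun _ => c) = c := by
  have := pathExp_take A R (Nat.zero_le n) (fun _ => c)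
  rw [this]
  simp [pathExp, pathWeight]

lemma pathExp_mono {n : ℕ} {f g : (Fin n → Fin K) → ℝ} (h : ∀ J, f J ≤ g J) :
    pathExp A R n f ≤ pathExp A R n g :=
  Finset.sum_le_sum fun J _ => mul_le_mul_of_nonneg_left (h J) (pathWeight_nonneg A R n J)

lemma pathExp_add {n : ℕ} (f g : (Fin n → Fin K) → ℝ) :
    pathExp A R n (fun J => f J + g J) = pathExp A R n f + pathExp A R n g := by
  simp only [pathExp, mul_add, Finset.sum_add_distrib]

lemma pathExp_sub {n : ℕ} (f g : (Fin n → Fin K) → ℝ) :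
    pathExp A R n (fun J => f J - g J) = pathExp A R n f - pathExp A R n g := by
  simp only [pathExp, mul_sub, Finset.sum_sub_distrib]

lemma pathExp_const_mul {n : ℕ} (c : ℝ) (f : (Fin n → Fin K) → ℝ) :
    pathExp A R n (fun J => c * f J) = c * pathExp A R n f := by
  simp only [pathExp, Finset.mul_sum]
  exact Finset.sum_congr rfl fun J _ => by ring

lemma pathExp_sum_nextProb_mul (n : ℕ) (g : Fin K → ℝ) :
    pathExp A R n (fun J => ∑ a, nextProb A R n J a * g a) = ∑ a, recMarginal A R n a * g a := by
  simp only [recMarginal, pathExp, Finset.mul_sum, Finset.sum_mul]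
  rw [Finset.sum_comm]
  simp only [mul_assoc]

lemma recMarginal_nonneg (n : ℕ) (a : Fin K) : 0 ≤ recMarginal A R n a :=
  Finset.sum_nonneg fun J _ => mul_nonneg (pathWeight_nonneg A R n J) (nextProb_nonneg A R n J a)

lemma sum_recMarginal (n : ℕ) : ∑ a, recMarginal A R n a = 1 := by
  have := pathExp_sum_nextProb_mul A R n fun _ => 1
  simp only [mul_one, sum_nextProb] at this
  rw [← this, pathExp_const]

lemma recMarginal_le_one (n : ℕ) (a : Fin K) : recMarginal A R n a ≤ 1 := by
  rw [← sum_recMarginal A R n]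
  exact Finset.single_le_sum (fun b _ => recMarginal_nonneg A R n b) (Finset.mem_univ a)

lemma pathExp_apply {T : ℕ} (t : Fin T) (g : Fin K → ℝ) :
    pathExp A R T (fun I => g (I t)) = ∑ a, recMarginal A R t a * g a := by
  have h := pathExp_take A R (Nat.succ_le_of_lt t.2) (fun I => g (I (Fin.last _)))
  have h' : (fun I : Fin T → Fin K => g (I (Fin.castLE (Nat.succ_le_of_lt t.2) (Fin.last _)))) =
      fun I => g (I t) := rfl
  rw [h'] at h
  rw [h, pathExp_succ]
  simp only [Fin.snoc_last]
  exact pathExp_sum_nextProb_mul A R t g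

/-- Causality: only records of rounds before `n` enter. This yields both the irrelevance of an
agent's own deviation and the independence of a round's reward from its recommendation. -/
lemma recMarginal_congr {R R' : ℕ → Fin K → RoundRecord K} {n : ℕ}
    (h : ∀ s < n, R s = R' s) (a : Fin K) : recMarginal A R n a = recMarginal A R' n a := by
  have hn : ∀ m ≤ n, ∀ (J : Fin m → Fin K) b, nextProb A R m J b = nextProb A R' m J b := by
    intro m hm J b
    unfold nextProb
    congr 1
    funext s
    rw [h s (s.2.trans_le hm)]
  unfold recMarginal pathExp pathWeight
  refine Finset.sum_congr rfl fun J _ => ?_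
  beta_reduce
  rw [hn n le_rfl]
  congr 1
  exact Finset.prod_congr rfl fun t _ => hn t t.2.le _ _

end Path

/-! ### Interval regret of Exp4.S against a fixed sequence of rewards -/

/-- Invert exp x ≥ 1 + x + x²/2 and use (1 + x + x²/2)(1 - x + x²/2) = 1 + x⁴/4 ≥ 1. -/
lemma exp_neg_le_quadratic {x : ℝ} (hx : 0 ≤ x) : Real.exp (-x) ≤ 1 - x + x ^ 2 / 2 := by
  have h := Real.quadratic_le_exp_of_nonneg hx
  rw [Real.exp_neg, inv_le_comm₀ (Real.exp_pos x) (by nlinarith [sq_nonneg (x - 1)])]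
  refine le_trans ?_ h
  rw [inv_le_iff_one_le_mul₀ (by nlinarith [sq_nonneg (x - 1)])]
  nlinarith [sq_nonneg (x ^ 2)]

/-- One round of exponential weights with bandit feedback, for the played action `a`. -/
lemma exp_weights_step {K : ℕ} {p : Fin K → ℝ} (hp : ∀ b, 0 < p b) (hs : ∑ b, p b = 1)
    {η r : ℝ} (hη : 0 < η) (hr : r ≤ 1) (a e : Fin K) :
    η * ((1 - r) - exp4sLossEst p a r e) ≤
      Real.log (p e * Real.exp (-η * exp4sLossEst p a r e) /
        ∑ c, p c * Real.exp (-η * exp4sLossEst p a r c)) - Real.log (p e) +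
      η ^ 2 / 2 * ((1 - r) ^ 2 / p a) := by
  set l := exp4sLossEst p a r with hl
  have hl0 : ∀ b, 0 ≤ l b := fun b => by
    simp only [hl, exp4sLossEst]
    split_ifs
    · exact div_nonneg (by linarith) (hp b).le
    · exact le_rfl
  have hZ : 0 < ∑ c, p c * Real.exp (-η * l c) :=
    Finset.sum_pos (fun c _ => mul_pos (hp c) (Real.exp_pos _)) ⟨a, Finset.mem_univ a⟩
  have h1 : ∑ c, p c * l c = 1 - r := by
    simp only [hl, exp4sLossEst, mul_ite, mul_zero, Finset.sum_ite_eq', Finset.mem_univ, if_true]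
    field_simp [(hp a).ne']
  have h2 : ∑ c, p c * l c ^ 2 = (1 - r) ^ 2 / p a := by
    simp only [hl, exp4sLossEst, ite_pow, mul_ite, mul_zero, ne_eq, OfNat.ofNat_ne_zero,
      not_false_eq_true, zero_pow, Finset.sum_ite_eq', Finset.mem_univ, if_true]
    field_simp [(hp a).ne']
  -- The quadratic bound on the exponential is averaged under p; the first two moments of the loss
  -- estimate are `h1` and `h2`.
  have hZle : ∑ c, p c * Real.exp (-η * l c) ≤
      1 - η * (1 - r) + η ^ 2 / 2 * ((1 - r) ^ 2 / p a) := by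
    rw [← h2, ← h1, ← hs, Finset.mul_sum, Finset.mul_sum, ← Finset.sum_sub_distrib,
      ← Finset.sum_add_distrib]
    refine Finset.sum_le_sum fun c _ => ?_
    have := mul_le_mul_of_nonneg_left (exp_neg_le_quadratic (mul_nonneg hη.le (hl0 c))) (hp c).le
    rw [neg_mul]
    linarith
  have hlog := Real.log_le_sub_one_of_pos hZ
  rw [Real.log_div (mul_pos (hp e) (Real.exp_pos _)).ne' hZ.ne',
    Real.log_mul (hp e).ne' (Real.exp_pos _).ne', Real.log_exp]
  linarith

section Regret

variable {K T : ℕ} [NeZero K]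

lemma exp4sShare_le_prob (hT : 0 < T) (n : ℕ) (h : Fin n → RoundRecord K) (a : Fin K) :
    exp4sShare K T ≤ exp4sProb K T n h a := by
  have hK : (0 : ℝ) < K := by exact_mod_cast NeZero.pos K
  have hT' : (1 : ℝ) ≤ T := by exact_mod_cast hT
  cases n with
  | zero =>
    simp only [exp4sProb, exp4sShare]
    apply one_div_le_one_div_of_le hK
    nlinarith
  | succ n =>
    simp only [exp4sProb, exp4sUpdate]
    have hp := (exp4sProb_nonneg_sum K T n (fun s => h s.castSucc)).1
    have h1 := mul_exp4sShare_le_one K T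
    refine le_add_of_nonneg_left (mul_nonneg (by linarith) (div_nonneg ?_ ?_))
    · exact mul_nonneg (hp _) (Real.exp_pos _).le
    · exact Finset.sum_nonneg fun c _ => mul_nonneg (hp _) (Real.exp_pos _).le

lemma exp4sShare_pos (hT : 0 < T) : 0 < exp4sShare K T := by
  have hK : (0 : ℝ) < K := by exact_mod_cast NeZero.pos K
  have hT' : (0 : ℝ) < T := by exact_mod_cast hT
  unfold exp4sShare; positivity

lemma exp4sRate_pos (hT : 2 ≤ T) : 0 < exp4sRate K T := by
  have hK : (1 : ℝ) ≤ K := by exact_mod_cast NeZero.pos K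
  have hT' : (2 : ℝ) ≤ T := by exact_mod_cast hT
  have h : (1 : ℝ) < K * T := by nlinarith
  exact Real.sqrt_pos.2 (div_pos (Real.log_pos h) (by linarith))

/-- One update of Exp4.S: the fixed share costs at most `2 / T` in the potential. -/
lemma exp4sUpdate_step (hT : 2 ≤ T) {p : Fin K → ℝ} (hp : ∀ b, 0 < p b) (hs : ∑ b, p b = 1)
    {r : ℝ} (hr : r ≤ 1) (a e : Fin K) :
    exp4sRate K T * ((1 - r) - exp4sLossEst p a r e) ≤
      Real.log (exp4sUpdate T p a r e) - Real.log (p e) + 2 / T +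
      exp4sRate K T ^ 2 / 2 * ((1 - r) ^ 2 / p a) := by
  have hK : (0 : ℝ) < K := by exact_mod_cast NeZero.pos K
  have hT' : (2 : ℝ) ≤ T := by exact_mod_cast hT
  have h := exp_weights_step hp hs (exp4sRate_pos (K := K) hT) hr a e
  set q := p e * Real.exp (-exp4sRate K T * exp4sLossEst p a r e) /
        ∑ c, p c * Real.exp (-exp4sRate K T * exp4sLossEst p a r c) with hq
  have hq0 : 0 < q := div_pos (mul_pos (hp e) (Real.exp_pos _))
    (Finset.sum_pos (fun c _ => mul_pos (hp c) (Real.exp_pos _)) ⟨a, Finset.mem_univ a⟩)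
  have hKs : (K : ℝ) * exp4sShare K T = 1 / T := by
    unfold exp4sShare; field_simp
  have hTi : (1 : ℝ) / T ≤ 1 / 2 := one_div_le_one_div_of_le (by norm_num) hT'
  have hpos : (0 : ℝ) < 1 - 1 / T := by linarith
  -- The added uniform mass is discarded; only the shrinking factor 1 - Kγ = 1 - 1/T costs
  -- potential.
  have h1 : Real.log ((1 - 1 / T) * q) ≤ Real.log (exp4sUpdate T p a r e) := by
    apply Real.log_le_log (mul_pos hpos hq0)
    unfold exp4sUpdate
    rw [hKs, ← hq]
    exact le_add_of_nonneg_right (exp4sShare_nonneg K T)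
  -- From log x ≥ 1 - 1/x, and 1/(1 - y) ≤ 1 + 2y for 0 ≤ y ≤ 1/2; this is where T ≥ 2 is needed.
  have h2 : -(2 / (T : ℝ)) ≤ Real.log (1 - 1 / T) := by
    have h3 := Real.one_sub_inv_le_log_of_pos hpos
    refine le_trans ?_ h3
    have h4 : (1 - 1 / (T : ℝ))⁻¹ ≤ 1 + 2 / T := by
      rw [inv_le_iff_one_le_mul₀ hpos]
      have h5 : (0 : ℝ) ≤ 1 / T := by positivity
      have h6 : (2 : ℝ) / T = 2 * (1 / T) := by ring
      rw [h6]
      nlinarith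
    linarith
  rw [Real.log_mul hpos.ne' hq0.ne'] at h1
  linarith

/-- The records of compliant play against the rewards `u`. -/
def compliantRecord (u : ℕ → Fin K → ℝ) (s : ℕ) (c : Fin K) : RoundRecord K := (c, c, u s c)

lemma exp4S_nextProb_pos (hT : 0 < T) (R : ℕ → Fin K → RoundRecord K) (n : ℕ)
    (J : Fin n → Fin K) (a : Fin K) : exp4sShare K T ≤ nextProb (exp4S K T) R n J a :=
  exp4sShare_le_prob hT n _ a

/-- Under compliance the last recommendation is also the played action, so the recursion of the
algorithm becomes a recursion along recommendation paths. -/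
lemma exp4S_nextProb_snoc (u : ℕ → Fin K → ℝ) (n : ℕ) (J : Fin n → Fin K) (a e : Fin K) :
    nextProb (exp4S K T) (compliantRecord u) (n + 1) (Fin.snoc (α := fun _ => Fin K) J a) e =
      exp4sUpdate T (nextProb (exp4S K T) (compliantRecord u) n J) a (u n a) e := by
  simp only [nextProb, exp4S, exp4sProb, compliantRecord, Fin.snoc_last, Fin.snoc_castSucc,
    Fin.val_castSucc, Fin.val_last]
  rfl

/-- Expected regret of one round, in terms of the potential `log p(e)`. -/
lemma exp4S_round_regret (hT : 2 ≤ T) {u : ℕ → Fin K → ℝ} (hu : ∀ t a, u t a ∈ Set.Icc (0 : ℝ) 1)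
    (n : ℕ) (e : Fin K) :
    exp4sRate K T * (u n e - ∑ a, recMarginal (exp4S K T) (compliantRecord u) n a * u n a) ≤
      pathExp (exp4S K T) (compliantRecord u) (n + 1)
        (fun J => Real.log (nextProb (exp4S K T) (compliantRecord u) (n + 1) J e)) -
      pathExp (exp4S K T) (compliantRecord u) n
        (fun J => Real.log (nextProb (exp4S K T) (compliantRecord u) n J e)) +
      (2 / T + exp4sRate K T ^ 2 / 2 * K) := by
  set η := exp4sRate K T
  rw [pathExp_succ, ← pathExp_sum_nextProb_mul,
    ← pathExp_const (exp4S K T) (compliantRecord u) n (u n e), ← pathExp_sub,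
    ← pathExp_sub, ← pathExp_const_mul,
    ← pathExp_const (exp4S K T) (compliantRecord u) n (2 / T + η ^ 2 / 2 * K), ← pathExp_add]
  refine pathExp_mono _ _ fun J => ?_
  simp only [exp4S_nextProb_snoc]
  set p := nextProb (exp4S K T) (compliantRecord u) n J with hpdef
  have hp : ∀ b, 0 < p b := fun b =>
    (exp4sShare_pos (K := K) (by omega)).trans_le (exp4S_nextProb_pos (by omega) _ n J b)
  have hs : ∑ b, p b = 1 := sum_nextProb _ _ _ _
  have hstep : ∑ a, p a * (η * ((1 - u n a) - exp4sLossEst p a (u n a) e)) ≤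
      ∑ a, p a * (Real.log (exp4sUpdate T p a (u n a) e) - Real.log (p e) + 2 / T +
        η ^ 2 / 2 * ((1 - u n a) ^ 2 / p a)) :=
    Finset.sum_le_sum fun a _ => mul_le_mul_of_nonneg_left
      (exp4sUpdate_step hT hp hs (hu n a).2 a e) (hp a).le
  -- The importance-weighted loss estimate is unbiased.
  have hl : ∑ a, p a * exp4sLossEst p a (u n a) e = 1 - u n e := by
    simp only [exp4sLossEst, mul_ite, mul_zero, Finset.sum_ite_eq, Finset.mem_univ, if_true]
    field_simp [(hp e).ne']
  have hlhs : ∑ a, p a * (η * ((1 - u n a) - exp4sLossEst p a (u n a) e)) =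
      η * (u n e - ∑ a, p a * u n a) := by
    have : ∀ a, p a * (η * ((1 - u n a) - exp4sLossEst p a (u n a) e)) =
        η * (p a - p a * u n a - p a * exp4sLossEst p a (u n a) e) := fun a => by ring
    simp only [this, ← Finset.mul_sum, Finset.sum_sub_distrib, hl, hs]
    ring
  -- Sampling with probability p a cancels one importance weight, leaving K terms of size at most 1.
  have hsq : ∑ a, p a * ((1 - u n a) ^ 2 / p a) ≤ (K : ℝ) := by
    calc ∑ a, p a * ((1 - u n a) ^ 2 / p a) ≤ ∑ a : Fin K, (1 : ℝ) := by
          refine Finset.sum_le_sum fun a _ => ?_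
          rw [mul_div_cancel₀ _ (hp a).ne']
          nlinarith [(hu n a).1, (hu n a).2]
      _ = K := by simp
  have hrhs : ∑ a, p a * (Real.log (exp4sUpdate T p a (u n a) e) - Real.log (p e) + 2 / T +
        η ^ 2 / 2 * ((1 - u n a) ^ 2 / p a)) =
      ∑ a, p a * Real.log (exp4sUpdate T p a (u n a) e) - Real.log (p e) + 2 / T +
        η ^ 2 / 2 * ∑ a, p a * ((1 - u n a) ^ 2 / p a) := by
    have : ∀ a, p a * (Real.log (exp4sUpdate T p a (u n a) e) - Real.log (p e) + 2 / T +
        η ^ 2 / 2 * ((1 - u n a) ^ 2 / p a)) =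
        p a * Real.log (exp4sUpdate T p a (u n a) e) - p a * Real.log (p e) + p a * (2 / T) +
        η ^ 2 / 2 * (p a * ((1 - u n a) ^ 2 / p a)) := fun a => by ring
    simp only [this, Finset.sum_add_distrib, Finset.sum_sub_distrib, ← Finset.mul_sum,
      ← Finset.sum_mul, hs, one_mul]
  rw [hlhs, hrhs] at hstep
  have := mul_le_mul_of_nonneg_left hsq (by positivity : 0 ≤ η ^ 2 / 2)
  linarith

/-- Regret of Exp4.S on every interval, for `T ≥ 2` rounds. -/
lemma exp4S_interval_regret_aux (hT : 2 ≤ T) {u : ℕ → Fin K → ℝ}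
    (hu : ∀ t a, u t a ∈ Set.Icc (0 : ℝ) 1) (s L : ℕ) (hL : L ≤ T) (e : Fin K) :
    exp4sRate K T * ∑ t ∈ Finset.range L, (u (s + t) e -
        ∑ a, recMarginal (exp4S K T) (compliantRecord u) (s + t) a * u (s + t) a) ≤
      Real.log (K * T) + 2 + exp4sRate K T ^ 2 / 2 * (K * T) := by
  have hK : (0 : ℝ) < K := by exact_mod_cast NeZero.pos K
  have hT' : (2 : ℝ) ≤ T := by exact_mod_cast hT
  have hL' : (L : ℝ) ≤ T := by exact_mod_cast hL
  set φ : ℕ → ℝ := fun n => pathExp (exp4S K T) (compliantRecord u) n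
        (fun J => Real.log (nextProb (exp4S K T) (compliantRecord u) n J e)) with hφ
  have hsum : exp4sRate K T * ∑ t ∈ Finset.range L, (u (s + t) e -
        ∑ a, recMarginal (exp4S K T) (compliantRecord u) (s + t) a * u (s + t) a) ≤
      φ (s + L) - φ s + L * (2 / T + exp4sRate K T ^ 2 / 2 * K) := by
    rw [Finset.mul_sum]
    calc _ ≤ ∑ t ∈ Finset.range L, (φ (s + (t + 1)) - φ (s + t) +
          (2 / T + exp4sRate K T ^ 2 / 2 * K)) :=
          Finset.sum_le_sum fun t _ => exp4S_round_regret hT hu (s + t) e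
      _ = _ := by
          rw [Finset.sum_add_distrib, Finset.sum_range_sub (fun t => φ (s + t))]
          simp only [add_zero, Finset.sum_const, Finset.card_range, nsmul_eq_mul]
  have hup : φ (s + L) ≤ 0 := by
    rw [← pathExp_const (exp4S K T) (compliantRecord u) (s + L) 0]
    refine pathExp_mono _ _ fun J => Real.log_nonpos (nextProb_nonneg _ _ _ _ _) ?_
    rw [← sum_nextProb (exp4S K T) (compliantRecord u) _ J]
    exact Finset.single_le_sum (fun b _ => nextProb_nonneg _ _ _ _ b) (Finset.mem_univ e)
  -- The fixed share bounds the potential below at an arbitrary starting round, which is what gives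
  -- regret on every interval.
  have hlow : -Real.log (K * T) ≤ φ s := by
    rw [← pathExp_const (exp4S K T) (compliantRecord u) s (-Real.log (K * T))]
    refine pathExp_mono _ _ fun J => ?_
    rw [← Real.log_inv]
    refine Real.log_le_log (by positivity) ?_
    have := exp4S_nextProb_pos (T := T) (by omega) (compliantRecord u) s J e
    rwa [exp4sShare, one_div] at this
  have hlin : L * (2 / T + exp4sRate K T ^ 2 / 2 * K) ≤
      2 + exp4sRate K T ^ 2 / 2 * (K * T) := by
    calc L * (2 / T + exp4sRate K T ^ 2 / 2 * K) ≤ T * (2 / T + exp4sRate K T ^ 2 / 2 * K) :=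
          mul_le_mul_of_nonneg_right hL' (by positivity)
      _ = _ := by field_simp
  linarith

/-- Regret of Exp4.S with parameter `T` on every interval of at most `T` rounds. -/
lemma exp4S_interval_regret {u : ℕ → Fin K → ℝ}
    (hu : ∀ t a, u t a ∈ Set.Icc (0 : ℝ) 1) (s L : ℕ) (hL : L ≤ T) (e : Fin K) :
    ∑ t ∈ Finset.range L, (u (s + t) e -
        ∑ a, recMarginal (exp4S K T) (compliantRecord u) (s + t) a * u (s + t) a) ≤
      5 * √((T : ℝ) * K * Real.log ((T : ℝ) * K)) := by
  have hK1 : 1 ≤ K := NeZero.pos K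
  have hK : (1 : ℝ) ≤ K := by exact_mod_cast hK1
  -- For T = 1 the share takes all the mass and the potential argument fails. A single action has
  -- zero regret, and for K ≥ 2 the trivial bound 1 suffices.
  rcases Nat.lt_or_ge T 2 with hT | hT
  · rcases Nat.eq_zero_or_pos L with rfl | hL0
    · simp
    obtain rfl : T = 1 := by omega
    obtain rfl : L = 1 := by omega
    simp only [Finset.range_one, Finset.sum_singleton, Nat.cast_one, one_mul]
    rcases hK1.eq_or_lt with rfl | hK2
    · have h1 := sum_recMarginal (exp4S 1 1) (compliantRecord u) (s + 0)
      simp only [Finset.univ_unique, Finset.sum_singleton] at h1 ⊢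
      rw [h1, Subsingleton.elim e default]
      simp
    · have hK2' : (2 : ℝ) ≤ K := by exact_mod_cast hK2
      have h0 : 0 ≤ ∑ a, recMarginal (exp4S K 1) (compliantRecord u) (s + 0) a * u (s + 0) a :=
        Finset.sum_nonneg fun a _ => mul_nonneg (recMarginal_nonneg _ _ _ _) (hu _ _).1
      have hlog : (1 : ℝ) / 2 ≤ Real.log K :=
        le_trans (by linarith [Real.log_two_gt_d9]) (Real.log_le_log (by norm_num) hK2')
      have : 1 ≤ √(K * Real.log K) := Real.one_le_sqrt.2 (by nlinarith)
      linarith [(hu (s + 0) e).2]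
  have hT' : (2 : ℝ) ≤ T := by exact_mod_cast hT
  have hη := exp4sRate_pos (K := K) hT
  have h := exp4S_interval_regret_aux hT hu s L hL e
  have hX : (2 : ℝ) ≤ K * T := by nlinarith
  rw [mul_comm (T : ℝ) K]
  set X : ℝ := K * T with hXdef
  have hlog : (69 : ℝ) / 100 ≤ Real.log X :=
    le_trans (by linarith [Real.log_two_gt_d9]) (Real.log_le_log (by norm_num) hX)
  have hsq : exp4sRate K T ^ 2 * X = Real.log X := by
    unfold exp4sRate
    rw [← hXdef, Real.sq_sqrt (div_nonneg (by linarith) (by linarith))]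
    field_simp
  -- The learning rate is tuned so that η√(X log X) = log X = η²X. After multiplying by η, the claim
  -- is (3/2) log X + 2 ≤ 5 log X, which holds since log X ≥ log 2 > 0.69.
  have hprod : exp4sRate K T * √(X * Real.log X) = Real.log X := by
    unfold exp4sRate
    rw [← hXdef, ← Real.sqrt_mul (div_nonneg (by linarith) (by linarith))]
    rw [show Real.log X / X * (X * Real.log X) = Real.log X ^ 2 by field_simp]
    exact Real.sqrt_sq (by linarith)
  refine le_of_mul_le_mul_left ?_ hη
  rw [show exp4sRate K T * (5 * √(X * Real.log X)) = 5 * (exp4sRate K T * √(X * Real.log X)) by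
    ring, hprod]
  have : exp4sRate K T ^ 2 / 2 * X = Real.log X / 2 := by rw [← hsq]; ring
  linarith

end Regret

/-! ### The recommendation game under a belief -/

section Game

variable {K T : ℕ}

/-- Extension of a sequence indexed by `T` rounds to all natural numbers, by zero. -/
def extendRewards (u : RewardSeq T K) (n : ℕ) (a : Fin K) : ℝ :=
  if h : n < T then u ⟨n, h⟩ a else 0

lemma extendRewards_coe (u : RewardSeq T K) (t : Fin T) (a : Fin K) :
    extendRewards u t a = u t a := by
  simp [extendRewards]

lemma extendRewards_mem {u : RewardSeq T K} (hu : ∀ t a, u t a ∈ Set.Icc (0 : ℝ) 1) (n : ℕ)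
    (a : Fin K) : extendRewards u n a ∈ Set.Icc (0 : ℝ) 1 := by
  unfold extendRewards
  split_ifs
  · exact hu _ _
  · simp

lemma measurable_extendRewards (n : ℕ) (a : Fin K) :
    Measurable fun u : RewardSeq T K => extendRewards u n a := by
  unfold extendRewards
  split_ifs with h
  · exact (measurable_pi_apply a).comp (measurable_pi_apply (⟨n, h⟩ : Fin T))
  · exact measurable_const

/-- `roundRecord` as a function of the recommendation of the round. -/
def playRecord (σ : Profile T K) (τ : Equiv.Perm (Fin T)) (u : RewardSeq T K) (s : ℕ)
    (c : Fin K) : RoundRecord K :=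
  if h : s < T then (c, σ (τ.symm ⟨s, h⟩) c, u ⟨s, h⟩ (σ (τ.symm ⟨s, h⟩) c)) else (c, c, 0)

lemma pathProb_eq_pathWeight (A : BanditAlgorithm K) (σ : Profile T K) (τ : Equiv.Perm (Fin T))
    (u : RewardSeq T K) (I : Fin T → Fin K) :
    pathProb A σ τ u I = pathWeight A (playRecord σ τ u) T I := by
  unfold pathProb pathWeight nextProb
  refine Finset.prod_congr rfl fun t _ => ?_
  congr 1
  funext s
  simp only [roundRecord, playRecord, dif_pos (s.2.trans t.2)]

/-- Probability of being recommended `a` in round `n` of compliant play against rewards `u`. -/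
def roundProb (A : BanditAlgorithm K) (u : RewardSeq T K) (n : ℕ) (a : Fin K) : ℝ :=
  recMarginal A (compliantRecord (extendRewards u)) n a

/-- A deviation of agent `i` does not change the law of her own recommendation. -/
lemma sum_pathProb_update_mul (A : BanditAlgorithm K) (i : Fin T) (σ' : Fin K → Fin K)
    (τ : Equiv.Perm (Fin T)) (u : RewardSeq T K) (g : Fin K → ℝ) :
    ∑ I, pathProb A (Function.update (compliant T K) i σ') τ u I * g (I (τ i)) =
      ∑ a, roundProb A u (τ i) a * g a := by
  simp only [pathProb_eq_pathWeight]
  have h := pathExp_apply A (playRecord (Function.update (compliant T K) i σ') τ u) (τ i) g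
  rw [pathExp] at h
  rw [h]
  refine Finset.sum_congr rfl fun a _ => ?_
  congr 1
  refine recMarginal_congr A (fun s hs => ?_) a
  have hsT : s < T := hs.trans (τ i).2
  -- Agent i arrives in round τ i, so every earlier round is played by someone compliant.
  have hne : τ.symm ⟨s, hsT⟩ ≠ i := by
    intro he
    rw [Equiv.symm_apply_eq] at he
    rw [← he] at hs
    exact lt_irrefl _ hs
  funext c
  simp [playRecord, compliantRecord, extendRewards, hsT, Function.update_of_ne hne, compliant]

lemma measurable_roundProb (A : BanditAlgorithm K) (n : ℕ) (a : Fin K) :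
    Measurable fun u : RewardSeq T K => roundProb A u n a := by
  have hnext : ∀ m (J : Fin m → Fin K) b, Measurable fun u : RewardSeq T K =>
      nextProb A (compliantRecord (extendRewards u)) m J b := fun m J b => by
    unfold nextProb
    refine (A.prob_measurable m b).comp (measurable_pi_lambda _ fun s => ?_)
    unfold compliantRecord
    exact measurable_const.prodMk (measurable_const.prodMk (measurable_extendRewards _ _))
  unfold roundProb recMarginal pathExp pathWeight
  exact Finset.measurable_sum _ fun J _ =>
    (Finset.measurable_prod _ fun t _ => hnext _ _ _).mul (hnext _ _ _)

lemma roundProb_nonneg (A : BanditAlgorithm K) (u : RewardSeq T K) (n : ℕ) (a : Fin K) :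
    0 ≤ roundProb A u n a := recMarginal_nonneg _ _ _ _

lemma roundProb_le_one (A : BanditAlgorithm K) (u : RewardSeq T K) (n : ℕ) (a : Fin K) :
    roundProb A u n a ≤ 1 := recMarginal_le_one _ _ _ _

lemma integrable_roundProb_mul {Ω : Type*} [MeasurableSpace Ω] {P : Measure Ω} [IsFiniteMeasure P]
    (A : BanditAlgorithm K) (n : ℕ) (a : Fin K) {X : Ω → RewardSeq T K} (hX : Measurable X)
    {v : Ω → ℝ} (hv : Measurable v) (hv1 : ∀ᵐ x ∂P, v x ∈ Set.Icc (0 : ℝ) 1) :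
    Integrable (fun x => roundProb A (X x) n a * v x) P := by
  refine Integrable.of_bound (((measurable_roundProb A n a).comp hX).mul hv).aestronglyMeasurable
    1 ?_
  filter_upwards [hv1] with x hx
  rw [Real.norm_of_nonneg (mul_nonneg (roundProb_nonneg _ _ _ _) hx.1)]
  exact mul_le_one₀ (roundProb_le_one _ _ _ _) hx.1 hx.2

lemma integrable_roundProb {P : Measure (RewardSeq T K)} [IsFiniteMeasure P]
    (A : BanditAlgorithm K) (n : ℕ) (a : Fin K) :
    Integrable (fun u => roundProb A u n a) P := by
  simpa using integrable_roundProb_mul (P := P) A n a measurable_id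
    (measurable_const (a := (1 : ℝ))) (by simp)

instance (B : Belief T K) : IsProbabilityMeasure B.prior := B.prior_prob

instance (B : Belief T K) : IsMarkovKernel B.law := B.law_markov

/-- Probability of being recommended `a` in round `n` of compliant play, given the means `μ`. -/
def condRoundProb (A : BanditAlgorithm K) (B : Belief T K) (n : ℕ) (a : Fin K)
    (μ : RewardSeq T K) : ℝ :=
  ∫ u, roundProb A u n a ∂(B.law μ)

variable (A : BanditAlgorithm K) (B : Belief T K)

lemma condRoundProb_nonneg (n : ℕ) (a : Fin K) (μ : RewardSeq T K) :
    0 ≤ condRoundProb A B n a μ :=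
  integral_nonneg fun u => roundProb_nonneg A u n a

lemma sum_condRoundProb (n : ℕ) (μ : RewardSeq T K) : ∑ a, condRoundProb A B n a μ = 1 := by
  unfold condRoundProb
  rw [← integral_finsetSum _ fun a _ => integrable_roundProb A n a]
  have : ∀ u : RewardSeq T K, ∑ a, roundProb A u n a = 1 := fun u => sum_recMarginal _ _ _
  simp [this]

lemma condRoundProb_le_one (n : ℕ) (a : Fin K) (μ : RewardSeq T K) :
    condRoundProb A B n a μ ≤ 1 := by
  rw [← sum_condRoundProb A B n μ]
  exact Finset.single_le_sum (fun b _ => condRoundProb_nonneg A B n b μ) (Finset.mem_univ a)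

lemma measurable_condRoundProb (n : ℕ) (a : Fin K) : Measurable (condRoundProb A B n a) :=
  ((measurable_roundProb A n a).stronglyMeasurable.integral_kernel).measurable

lemma integrable_condRoundProb_mul (n : ℕ) (a : Fin K) {v : RewardSeq T K → ℝ} (hv : Measurable v)
    (hv1 : ∀ᵐ μ ∂B.prior, v μ ∈ Set.Icc (0 : ℝ) 1) :
    Integrable (fun μ => condRoundProb A B n a μ * v μ) B.prior := by
  refine Integrable.of_bound ((measurable_condRoundProb A B n a).mul hv).aestronglyMeasurable 1 ?_
  filter_upwards [hv1] with x hx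
  rw [Real.norm_of_nonneg (mul_nonneg (condRoundProb_nonneg _ _ _ _ _) hx.1)]
  exact mul_le_one₀ (condRoundProb_le_one _ _ _ _ _) hx.1 hx.2

lemma integrable_condRoundProb (n : ℕ) (a : Fin K) :
    Integrable (condRoundProb A B n a) B.prior := by
  simpa using integrable_condRoundProb_mul A B n a (measurable_const (a := (1 : ℝ))) (by simp)

/-- Only the marginal law of the agent's own arrival time matters for quantities that depend on τ
through τ i. -/
lemma sum_arrival_mul (i : Fin T) (G : Fin T → ℝ) :
    ∑ τ, (B.arrival τ).toReal * G (τ i) = ∑ t, B.temporal i t * G t := by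
  classical
  have h : ∀ t, B.temporal i t = ∑ τ, if t = τ i then (B.arrival τ).toReal else 0 := fun t => by
    unfold Belief.temporal
    rw [PMF.map_apply, tsum_fintype, ENNReal.toReal_sum]
    · refine Finset.sum_congr rfl fun τ _ => ?_
      split_ifs <;> simp
    · intro τ _
      split_ifs
      · exact B.arrival.apply_ne_top τ
      · simp
  simp only [h, Finset.sum_mul, ite_mul, zero_mul]
  rw [Finset.sum_comm]
  simp

/-- Expectation of a payoff of agent `i` on the event that she is recommended `a`. -/
lemma expect_update_indicator (i : Fin T) (σ' : Fin K → Fin K) (a : Fin K)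
    {v : Fin T → RewardSeq T K → ℝ} (hv : ∀ t, Measurable (v t))
    (hv1 : ∀ t, ∀ᵐ μ ∂B.prior, v t μ ∈ Set.Icc (0 : ℝ) 1) :
    expect A (Function.update (compliant T K) i σ') B
        (fun τ μ I => if I (τ i) = a then v (τ i) μ else 0) =
      ∑ t, B.temporal i t * ∫ μ, condRoundProb A B t a μ * v t μ ∂B.prior := by
  unfold expect
  rw [← sum_arrival_mul B i fun t => ∫ μ, condRoundProb A B t a μ * v t μ ∂B.prior]
  refine Finset.sum_congr rfl fun τ _ => ?_
  congr 1
  have h : ∀ x : RewardSeq T K × RewardSeq T K,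
      ∑ I : Fin T → Fin K, pathProb A (Function.update (compliant T K) i σ') τ x.2 I *
        (if I (τ i) = a then v (τ i) x.1 else 0) = roundProb A x.2 (τ i) a * v (τ i) x.1 := by
    intro x
    rw [sum_pathProb_update_mul A i σ' τ x.2 fun b => if b = a then v (τ i) x.1 else 0]
    simp
  simp only [h]
  -- Given μ the payoff is constant in u, so integrating out the rewards leaves `condRoundProb`.
  rw [Measure.integral_compProd]
  · simp only [condRoundProb, integral_mul_const]
  · refine integrable_roundProb_mul A _ a measurable_snd ((hv _).comp measurable_fst) ?_
    exact Measure.ae_compProd_of_ae_fst B.law (hv _ measurableSet_Icc) (hv1 (τ i))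

/-- The reward of a round is independent of the recommendation of that round given the means. -/
lemma integral_roundProb_mul_reward {μ : RewardSeq T K}
    (hind : iIndepFun (fun (t : Fin T) (u : RewardSeq T K) => u t) (B.law μ))
    (hmean : ∀ t a, ∫ u, u t a ∂(B.law μ) = μ t a) (n : ℕ) (a b : Fin K) :
    ∫ u, roundProb A u n a * extendRewards u n b ∂(B.law μ) =
      condRoundProb A B n a μ * extendRewards μ n b := by
  by_cases hn : n < T
  swap
  · simp [extendRewards, hn]
  set t : Fin T := ⟨n, hn⟩ with ht
  simp only [extendRewards, hn, dif_pos]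
  -- Erasing the rewards from round t on exhibits the recommendation probability as a function of
  -- the coordinates below t, which are independent of coordinate t.
  let mask : (Finset.Iio t → Fin K → ℝ) → RewardSeq T K := fun w s =>
    if h : s ∈ Finset.Iio t then w ⟨s, h⟩ else 0
  have hmask : Measurable mask := by
    refine measurable_pi_lambda _ fun s => ?_
    by_cases h : s ∈ Finset.Iio t
    · simp only [mask, dif_pos h]; exact measurable_pi_apply _
    · simp only [mask, dif_neg h]; exact measurable_const
  have hfactor : ∀ u : RewardSeq T K,
      roundProb A (mask fun s => u s) n a = roundProb A u n a := by
    intro u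
    refine recMarginal_congr A (fun s hs => ?_) a
    have hmem : (⟨s, hs.trans hn⟩ : Fin T) ∈ Finset.Iio t := by
      rw [Finset.mem_Iio]; exact hs
    funext c
    simp only [compliantRecord, extendRewards, dif_pos (hs.trans hn), mask, dif_pos hmem]
  have hψ : Measurable fun w : ({t} : Finset (Fin T)) → Fin K → ℝ =>
      w ⟨t, Finset.mem_singleton_self t⟩ b := by fun_prop
  have h1 := (hind.indepFun_finset (Finset.Iio t) {t} (by simp)
    (fun s => measurable_pi_apply s)).comp
    (φ := fun w => roundProb A (mask w) n a)
    (ψ := fun w => w ⟨t, Finset.mem_singleton_self t⟩ b)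
    ((measurable_roundProb A n a).comp hmask) hψ
  have h2 := h1.integral_fun_mul_eq_mul_integral
    (((measurable_roundProb A n a).comp hmask).comp
      (measurable_pi_lambda _ fun s => measurable_pi_apply _)).aestronglyMeasurable
    (hψ.comp (measurable_pi_lambda _ fun s => measurable_pi_apply _)).aestronglyMeasurable
  simp only [Function.comp_def, hfactor] at h2
  rw [h2, hmean, condRoundProb]

/-- Interval regret of Exp4.S with respect to the means. -/
lemma ae_interval_regret [NeZero K] (s L : ℕ) (hL : L ≤ T) :
    ∀ᵐ μ ∂B.prior, ∀ e, ∑ t ∈ Finset.range L, (extendRewards μ (s + t) e -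
        ∑ a, condRoundProb (exp4S K T) B (s + t) a μ * extendRewards μ (s + t) a) ≤
      5 * √((T : ℝ) * K * Real.log ((T : ℝ) * K)) := by
  filter_upwards [B.law_mem, B.law_indep, B.law_mean] with μ hmem hind hmean e
  have hu : ∀ n a, ∀ᵐ u ∂(B.law μ), extendRewards u n a ∈ Set.Icc (0 : ℝ) 1 := fun n a => by
    filter_upwards [hmem] with u hu using extendRewards_mem hu n a
  have hint1 : ∀ n a, Integrable (fun u => extendRewards u n a) (B.law μ) := fun n a => by
    refine Integrable.of_bound (measurable_extendRewards n a).aestronglyMeasurable 1 ?_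
    filter_upwards [hu n a] with u hu
    rw [Real.norm_of_nonneg hu.1]
    exact hu.2
  have hint2 : ∀ n a, Integrable (fun u => roundProb (exp4S K T) u n a * extendRewards u n a)
      (B.law μ) := fun n a =>
    integrable_roundProb_mul _ n a measurable_id (measurable_extendRewards n a) (hu n a)
  have hint3 : ∀ n, Integrable (fun u => extendRewards u n e -
      ∑ a, roundProb (exp4S K T) u n a * extendRewards u n a) (B.law μ) := fun n =>
    (hint1 n e).sub (integrable_finsetSum _ fun a _ => hint2 n a)
  have hmean' : ∀ n a, ∫ u, extendRewards u n a ∂(B.law μ) = extendRewards μ n a := fun n a => by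
    unfold extendRewards
    split_ifs
    · exact hmean _ _
    · simp
  have hle : ∫ u, ∑ t ∈ Finset.range L, (extendRewards u (s + t) e -
        ∑ a, roundProb (exp4S K T) u (s + t) a * extendRewards u (s + t) a) ∂(B.law μ) ≤
      ∫ _, 5 * √((T : ℝ) * K * Real.log ((T : ℝ) * K)) ∂(B.law μ) := by
    refine integral_mono_ae ?_ (integrable_const _) ?_
    · exact integrable_finsetSum _ fun t _ => hint3 (s + t)
    · filter_upwards [hmem] with u hu
      exact exp4S_interval_regret (extendRewards_mem hu) s L hL e
  rw [integral_const, probReal_univ, one_smul] at hle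
  refine le_of_eq_of_le ?_ hle
  rw [integral_finsetSum _ fun t _ => hint3 (s + t)]
  refine Finset.sum_congr rfl fun t _ => ?_
  rw [integral_sub (hint1 _ _) (integrable_finsetSum _ fun a _ => hint2 _ _),
    integral_finsetSum _ fun a _ => hint2 _ _, hmean']
  simp only [integral_roundProb_mul_reward (exp4S K T) B hind hmean]

end Game

/-! ### Slowly moving means on an interval -/

lemma sum_range_sub_cast (L : ℕ) : ∑ j ∈ Finset.range L, |(L : ℝ) - j| = L * (L + 1) / 2 := by
  have h : ∀ j ∈ Finset.range L, |(L : ℝ) - j| = (L : ℝ) - j := fun j hj => by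
    have : (j : ℝ) ≤ L := by exact_mod_cast (Finset.mem_range.1 hj).le
    exact abs_of_nonneg (by linarith)
  rw [Finset.sum_congr rfl h]
  clear h
  induction L with
  | zero => simp
  | succ n ih =>
    rw [Finset.sum_range_succ]
    have : ∑ j ∈ Finset.range n, (((n + 1 : ℕ) : ℝ) - j) =
        ∑ j ∈ Finset.range n, ((n : ℝ) - j) + n := by
      push_cast
      simp only [Finset.sum_sub_distrib, Finset.sum_const, Finset.card_range, nsmul_eq_mul]
      ring
    rw [this, ih]
    push_cast
    ring

/-- The worst position is an endpoint of the interval, where the distances are 0, …, L - 1. -/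
lemma sum_abs_sub_le {L i : ℕ} (hi : i < L) :
    ∑ j ∈ Finset.range L, |(i : ℝ) - j| ≤ L * (L - 1) / 2 := by
  induction L with
  | zero => omega
  | succ n ih =>
    rw [Finset.sum_range_succ]
    rcases (Nat.lt_succ_iff.1 hi).eq_or_lt with rfl | h
    · rw [sum_range_sub_cast]
      push_cast
      simp only [sub_self, abs_zero]
      linarith
    · have h1 : |(i : ℝ) - n| ≤ n := by
        have : (i : ℝ) ≤ n := by exact_mod_cast h.le
        rw [abs_le]
        constructor <;> linarith [(Nat.cast_nonneg i : (0 : ℝ) ≤ i)]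
      have := ih h
      push_cast
      linarith

/-- Source of the factor (L² - 1)/3 in the drift term of the error. -/
lemma sum_sum_abs_sub (L : ℕ) :
    ∑ i ∈ Finset.range L, ∑ j ∈ Finset.range L, |(i : ℝ) - j| = L * ((L : ℝ) ^ 2 - 1) / 3 := by
  induction L with
  | zero => simp
  | succ n ih =>
    rw [Finset.sum_range_succ]
    simp only [Finset.sum_range_succ, Finset.sum_add_distrib, ih, sub_self, abs_zero]
    have : ∑ i ∈ Finset.range n, |(i : ℝ) - n| = ∑ i ∈ Finset.range n, |(n : ℝ) - i| :=
      Finset.sum_congr rfl fun i _ => abs_sub_comm _ _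
    rw [this, sum_range_sub_cast]
    push_cast
    ring

section Drift

variable {K L : ℕ} {m p : ℕ → Fin K → ℝ} {ρ R : ℝ}

/-- Differences of slowly moving sequences stay close to their average. -/
lemma mul_sub_le_sum_sub (hm : ∀ i < L, ∀ j < L, ∀ a, |m i a - m j a| ≤ ρ * |(i : ℝ) - j|)
    {i : ℕ} (hi : i < L) (a b : Fin K) :
    L * (m i a - m i b) ≤ ∑ j ∈ Finset.range L, (m j a - m j b) +
      2 * ρ * ∑ j ∈ Finset.range L, |(i : ℝ) - j| := by
  have : L * (m i a - m i b) = ∑ j ∈ Finset.range L, (m i a - m i b) := by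
    rw [Finset.sum_const, Finset.card_range, nsmul_eq_mul]
  rw [this, Finset.mul_sum, ← Finset.sum_add_distrib]
  refine Finset.sum_le_sum fun j hj => ?_
  have h1 := abs_le.1 (hm i hi j (Finset.mem_range.1 hj) a)
  have h2 := abs_le.1 (hm i hi j (Finset.mem_range.1 hj) b)
  linarith [h1.2, h2.1]

/-- External regret bounds the gain from any fixed swap of recommendations, up to the drift. -/
lemma swap_gain_le [NeZero K]
    (hm : ∀ i < L, ∀ j < L, ∀ a, |m i a - m j a| ≤ ρ * |(i : ℝ) - j|)
    (hp : ∀ i a, 0 ≤ p i a) (hp1 : ∀ i, ∑ a, p i a = 1)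
    (hR : ∀ e, ∑ i ∈ Finset.range L, (m i e - ∑ a, p i a * m i a) ≤ R)
    (hL : 1 ≤ L) (a b : Fin K) :
    ∑ i ∈ Finset.range L, p i a * (m i b - m i a) ≤ R + 2 * ρ * ((L : ℝ) ^ 2 - 1) / 3 := by
  have hL0 : (0 : ℝ) < L := by exact_mod_cast hL
  -- Here `e` is the best fixed action over the interval and `c i` the best action of round i.
  obtain ⟨e, he⟩ := Finite.exists_max fun b => ∑ i ∈ Finset.range L, m i b
  choose c hc using fun i => Finite.exists_max (m i)
  have h1 : ∀ i ∈ Finset.range L, p i a * (m i b - m i a) ≤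
      (m i (c i) - m i e) + (m i e - ∑ a, p i a * m i a) := by
    intro i _
    -- Against the best action of the round every action has nonnegative regret, so the share of `a`
    -- is at most the total. This fails against the fixed benchmark `e`, hence the detour through `c
    -- i`.
    have h2 : p i a * (m i (c i) - m i a) ≤ ∑ d, p i d * (m i (c i) - m i d) :=
      Finset.single_le_sum (f := fun d => p i d * (m i (c i) - m i d))
        (fun d _ => mul_nonneg (hp i d) (sub_nonneg.2 (hc i d))) (Finset.mem_univ a)
    have h3 : ∑ d, p i d * (m i (c i) - m i d) = m i (c i) - ∑ d, p i d * m i d := by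
      simp only [mul_sub, Finset.sum_sub_distrib, ← Finset.sum_mul, hp1, one_mul]
    have h4 := mul_le_mul_of_nonneg_left (sub_le_sub_right (hc i b) (m i a)) (hp i a)
    linarith
  -- On average over the interval `c i` does not beat `e`, so its lead in round i is due to drift
  -- alone.
  have h5 : ∑ i ∈ Finset.range L, (m i (c i) - m i e) ≤ 2 * ρ * ((L : ℝ) ^ 2 - 1) / 3 := by
    refine le_of_mul_le_mul_left ?_ hL0
    calc (L : ℝ) * ∑ i ∈ Finset.range L, (m i (c i) - m i e)
        ≤ ∑ i ∈ Finset.range L, 2 * ρ * ∑ j ∈ Finset.range L, |(i : ℝ) - j| := by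
          rw [Finset.mul_sum]
          refine Finset.sum_le_sum fun i hi => ?_
          have h6 := mul_sub_le_sum_sub hm (Finset.mem_range.1 hi) (c i) e
          rw [Finset.sum_sub_distrib] at h6
          linarith [he (c i)]
      _ = L * (2 * ρ * ((L : ℝ) ^ 2 - 1) / 3) := by
          rw [← Finset.mul_sum, sum_sum_abs_sub]
          ring
  have h7 := Finset.sum_le_sum h1
  rw [Finset.sum_add_distrib] at h7
  linarith [hR e]

/-- Low regret forces most of the play onto an action that is better by `Δ` on average. -/
lemma le_sum_prob_of_gap (hρ : 0 ≤ ρ)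
    (hm : ∀ i < L, ∀ j < L, ∀ a, |m i a - m j a| ≤ ρ * |(i : ℝ) - j|)
    (hp : ∀ i a, 0 ≤ p i a) (hp1 : ∀ i, ∑ a, p i a = 1) {a : Fin K}
    (hR : ∑ i ∈ Finset.range L, (m i a - ∑ c, p i c * m i c) ≤ R) (hL : 1 ≤ L)
    {Δ : ℝ} (hΔ : ∀ b, b ≠ a → L * Δ ≤ ∑ j ∈ Finset.range L, (m j a - m j b)) :
    (Δ - ρ * (L - 1)) * (L - ∑ i ∈ Finset.range L, p i a) ≤ R := by
  have hL0 : (0 : ℝ) < L := by exact_mod_cast hL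
  -- An average lead of Δ can drop in a single round by at most (2ρ/L) · L(L-1)/2 = ρ(L-1).
  have hgap : ∀ i < L, ∀ b, b ≠ a → Δ - ρ * (L - 1) ≤ m i a - m i b := by
    intro i hi b hb
    have h1 := mul_sub_le_sum_sub hm hi b a
    have h2 := mul_le_mul_of_nonneg_left (sum_abs_sub_le hi) (by linarith : 0 ≤ 2 * ρ)
    have h3 := hΔ b hb
    have h4 : ∑ j ∈ Finset.range L, (m j b - m j a) =
        -∑ j ∈ Finset.range L, (m j a - m j b) := by
      rw [← Finset.sum_neg_distrib]
      exact Finset.sum_congr rfl fun _ _ => by ring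
    refine le_of_mul_le_mul_left ?_ hL0
    rw [h4] at h1
    linarith
  refine le_trans ?_ hR
  have hcard : (L : ℝ) - ∑ i ∈ Finset.range L, p i a = ∑ i ∈ Finset.range L, (1 - p i a) := by
    simp
  rw [hcard, Finset.mul_sum]
  refine Finset.sum_le_sum fun i hi => ?_
  have h1 : m i a - ∑ c, p i c * m i c = ∑ c, p i c * (m i a - m i c) := by
    simp only [mul_sub, Finset.sum_sub_distrib, ← Finset.sum_mul, hp1, one_mul]
  have h2 : 1 - p i a = ∑ c ∈ Finset.univ.erase a, p i c := by
    rw [← hp1 i, ← Finset.add_sum_erase _ _ (Finset.mem_univ a)]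
    ring
  rw [h1, h2, ← Finset.add_sum_erase _ _ (Finset.mem_univ a), sub_self, mul_zero, zero_add,
    Finset.mul_sum]
  refine Finset.sum_le_sum fun c hc => ?_
  rw [mul_comm]
  exact mul_le_mul_of_nonneg_left
    (hgap i (Finset.mem_range.1 hi) c (Finset.ne_of_mem_erase hc)) (hp i c)

end Drift

/-! ### Incentives of one agent -/

lemma sum_uniformInterval_mul {T s L : ℕ} (h : s + L ≤ T) (F : ℕ → ℝ) :
    ∑ t : Fin T, uniformInterval T s L t * F t = 1 / L * ∑ j ∈ Finset.range L, F (s + j) := by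
  unfold uniformInterval
  rw [Fin.sum_univ_eq_sum_range (fun n => (if s ≤ n ∧ n < s + L then 1 / (L : ℝ) else 0) * F n) T]
  simp only [ite_mul, zero_mul]
  rw [← Finset.sum_filter, Finset.mul_sum]
  have hIco : (Finset.range T).filter (fun n => s ≤ n ∧ n < s + L) = Finset.Ico s (s + L) := by
    ext n
    simp only [Finset.mem_filter, Finset.mem_range, Finset.mem_Ico]
    omega
  rw [hIco, Finset.sum_Ico_eq_sum_range]
  simp

section Agent

variable {K T : ℕ}

/-- One-step bounds accumulate by the triangle inequality. -/
lemma SlowlyMoving.ae_abs_sub_le {P : Measure (RewardSeq T K)} {ρ : ℝ} (h : SlowlyMoving P ρ) :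
    ∀ᵐ μ ∂P, ∀ i < T, ∀ j < T, ∀ a,
      |extendRewards μ i a - extendRewards μ j a| ≤ ρ * |(i : ℝ) - j| := by
  filter_upwards [h] with μ hμ
  have key : ∀ i j, i ≤ j → j < T → ∀ a,
      |extendRewards μ i a - extendRewards μ j a| ≤ ρ * ((j : ℝ) - i) := by
    intro i j hij
    induction j, hij using Nat.le_induction with
    | base => simp
    | succ j hij ih =>
      intro hj a
      have h1 := ih (by omega) a
      have h2 : |extendRewards μ j a - extendRewards μ (j + 1) a| ≤ ρ := by
        rw [abs_sub_comm]
        have h3 := (norm_le_pi_norm (μ ⟨j + 1, hj⟩ - μ ⟨j, by omega⟩) a).trans (hμ j hj)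
        simpa [extendRewards, hj, show j < T by omega] using h3
      have h4 := abs_sub_le (extendRewards μ i a) (extendRewards μ j a)
        (extendRewards μ (j + 1) a)
      push_cast
      linarith
  intro i hi j hj a
  rcases le_total i j with hij | hij
  · have : (i : ℝ) ≤ j := by exact_mod_cast hij
    rw [abs_sub_comm (i : ℝ), abs_of_nonneg (by linarith : (0 : ℝ) ≤ j - i)]
    exact key i j hij hj a
  · have : (j : ℝ) ≤ i := by exact_mod_cast hij
    rw [abs_sub_comm, abs_of_nonneg (by linarith : (0 : ℝ) ≤ i - j)]
    exact key j i hij hi a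

variable (A : BanditAlgorithm K) (B : Belief T K)

lemma ae_extendRewards_mem (n : ℕ) (a : Fin K) :
    ∀ᵐ μ ∂B.prior, extendRewards μ n a ∈ Set.Icc (0 : ℝ) 1 := by
  filter_upwards [B.prior_mem] with μ hμ using extendRewards_mem hμ n a

variable {B} {i : Fin T} {s L : ℕ}

lemma recProb_update_eq (hsL : s + L ≤ T) (hD : B.temporal i = uniformInterval T s L)
    (σ' : Fin K → Fin K) (a : Fin K) :
    recProb A (Function.update (compliant T K) i σ') B i a =
      1 / L * ∫ μ, ∑ j ∈ Finset.range L, condRoundProb A B (s + j) a μ ∂B.prior := by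
  unfold recProb
  rw [expect_update_indicator A B i σ' a (v := fun _ _ => 1) (fun _ => measurable_const)
    (by simp), hD, sum_uniformInterval_mul hsL fun n => ∫ μ, condRoundProb A B n a μ * 1 ∂B.prior,
    integral_finsetSum _ fun j _ => integrable_condRoundProb A B _ a]
  simp

lemma condPayoff_update_eq (hsL : s + L ≤ T) (hD : B.temporal i = uniformInterval T s L)
    (σ' : Fin K → Fin K) (a : Fin K) :
    condPayoff A (Function.update (compliant T K) i σ') B i a =
      (1 / L * ∫ μ, ∑ j ∈ Finset.range L, condRoundProb A B (s + j) a μ *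
        extendRewards μ (s + j) (σ' a) ∂B.prior) /
      (1 / L * ∫ μ, ∑ j ∈ Finset.range L, condRoundProb A B (s + j) a μ ∂B.prior) := by
  unfold condPayoff
  rw [recProb_update_eq A hsL hD]
  congr 1
  have h : (fun (τ : Equiv.Perm (Fin T)) (μ : RewardSeq T K) (I : Fin T → Fin K) =>
      if I (τ i) = a then
        μ (τ i) (Function.update (compliant T K) i σ' i (I (τ i))) else 0) =
      fun τ μ I => if I (τ i) = a then extendRewards μ (τ i) (σ' a) else 0 := by
    funext τ μ I
    split_ifs with hI
    · rw [Function.update_self, hI, extendRewards_coe]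
    · rfl
  rw [h, expect_update_indicator A B i σ' a (v := fun t μ => extendRewards μ t (σ' a))
    (fun t => measurable_extendRewards _ _) (fun t => ae_extendRewards_mem B _ _), hD,
    sum_uniformInterval_mul hsL
      fun n => ∫ μ, condRoundProb A B n a μ * extendRewards μ n (σ' a) ∂B.prior,
    integral_finsetSum _ fun j _ => integrable_condRoundProb_mul A B _ a
      (measurable_extendRewards _ _) (ae_extendRewards_mem B _ _)]

lemma gap_uniformInterval_le (hsL : s + L ≤ T) (hL : 1 ≤ L) {Δ : ℝ} {μ : RewardSeq T K}
    {a : Fin K} (h : (Δ : EReal) ≤ gap μ (uniformInterval T s L) a) (b : Fin K) (hb : b ≠ a) :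
    L * Δ ≤ ∑ j ∈ Finset.range L, (extendRewards μ (s + j) a - extendRewards μ (s + j) b) := by
  have hL0 : (0 : ℝ) < L := by exact_mod_cast hL
  have h1 := Finset.le_inf_iff.1 h b (Finset.mem_erase.2 ⟨hb, Finset.mem_univ b⟩)
  rw [EReal.coe_le_coe_iff] at h1
  have h2 := sum_uniformInterval_mul hsL fun n => extendRewards μ n a - extendRewards μ n b
  simp only [extendRewards_coe] at h2
  rw [h2, one_div, ← div_eq_inv_mul, le_div_iff₀ hL0] at h1
  linarith

/-- Lower bound on the probability of being recommended an explorable action. -/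
lemma le_recProb [NeZero K] (hL : 1 ≤ L) (hsL : s + L ≤ T)
    (hD : B.temporal i = uniformInterval T s L) {α Δ ρ : ℝ} (hρ : 0 ≤ ρ)
    (hexp : Explorable B.prior (B.temporal i) α Δ) (hslow : SlowlyMoving B.prior ρ)
    (hpos : 0 < Δ - ρ * (L - 1)) (hr : regretTerm 5 T K L ≤ Δ - ρ * (L - 1)) (a : Fin K) :
    α * ((Δ - ρ * (L - 1) - regretTerm 5 T K L) / (Δ - ρ * (L - 1))) ≤
      1 / L * ∫ μ, ∑ j ∈ Finset.range L, condRoundProb (exp4S K T) B (s + j) a μ ∂B.prior := by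
  have hL0 : (0 : ℝ) < L := by exact_mod_cast hL
  set D := Δ - ρ * (L - 1) with hDdef
  set r := regretTerm 5 T K L with hrdef
  have hrL : 5 * √((T : ℝ) * K * Real.log ((T : ℝ) * K)) = r * L := by
    rw [hrdef, regretTerm]; field_simp
  set Q : RewardSeq T K → ℝ := fun μ =>
    ∑ j ∈ Finset.range L, condRoundProb (exp4S K T) B (s + j) a μ with hQ
  -- Markov's inequality for the expected number `Q` of rounds of the interval in which `a` is
  -- recommended, given the means.
  have hmarkov := mul_meas_ge_le_integral_of_nonneg (μ := B.prior) (f := Q)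
    (ae_of_all _ fun μ => Finset.sum_nonneg fun j _ => condRoundProb_nonneg _ _ _ _ _)
    (integrable_finsetSum _ fun j _ => integrable_condRoundProb _ _ _ _) (L * ((D - r) / D))
  have hsub : B.prior.real {μ | (Δ : EReal) ≤ gap μ (B.temporal i) a} ≤
      B.prior.real {μ | L * ((D - r) / D) ≤ Q μ} := by
    refine ENNReal.toReal_mono (measure_ne_top _ _) (measure_mono_ae ?_)
    filter_upwards [ae_interval_regret B s L (by omega), hslow.ae_abs_sub_le] with μ hreg hdrift hμ
    have hμ' : (Δ : EReal) ≤ gap μ (B.temporal i) a := hμ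
    rw [hD] at hμ'
    have h := le_sum_prob_of_gap (m := fun j => extendRewards μ (s + j))
      (p := fun j a => condRoundProb (exp4S K T) B (s + j) a μ) hρ
      (fun i hi j hj a => by
        have := hdrift (s + i) (by omega) (s + j) (by omega) a
        push_cast at this
        rwa [add_sub_add_left_eq_sub] at this)
      (fun j a => condRoundProb_nonneg _ _ _ _ _) (fun j => sum_condRoundProb _ _ _ _)
      (hreg a) hL (gap_uniformInterval_le hsL hL hμ')
    change L * ((D - r) / D) ≤ Q μ
    rw [mul_div_assoc', div_le_iff₀ hpos]
    rw [hrL] at h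
    change D * (L - Q μ) ≤ r * L at h
    linarith
  have h1 := (hexp a).trans hsub
  have h2 : 0 ≤ (D - r) / D := div_nonneg (by linarith) hpos.le
  rw [one_div, ← div_eq_inv_mul, le_div_iff₀ hL0]
  calc α * ((D - r) / D) * L = L * ((D - r) / D) * α := by ring
    _ ≤ _ := (mul_le_mul_of_nonneg_left h1 (by positivity)).trans hmarkov

/-- Upper bound on the gain from replacing the recommendation `a` by `b`. -/
lemma deviation_gain_le [NeZero K] (hL : 1 ≤ L) (hsL : s + L ≤ T) {ρ : ℝ}
    (hslow : SlowlyMoving B.prior ρ) (a b : Fin K) :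
    1 / L * ∫ μ, ∑ j ∈ Finset.range L, condRoundProb (exp4S K T) B (s + j) a μ *
        extendRewards μ (s + j) b ∂B.prior ≤
      1 / L * ∫ μ, ∑ j ∈ Finset.range L, condRoundProb (exp4S K T) B (s + j) a μ *
        extendRewards μ (s + j) a ∂B.prior +
      (regretTerm 5 T K L + 2 * ρ * ((L : ℝ) ^ 2 - 1) / (3 * L)) := by
  have hL0 : (0 : ℝ) < L := by exact_mod_cast hL
  have hint : ∀ b, Integrable (fun μ => ∑ j ∈ Finset.range L,
      condRoundProb (exp4S K T) B (s + j) a μ * extendRewards μ (s + j) b) B.prior := fun b =>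
    integrable_finsetSum _ fun j _ => integrable_condRoundProb_mul _ B _ a
      (measurable_extendRewards _ _) (ae_extendRewards_mem B _ _)
  have h := integral_mono_ae ((hint b).sub (hint a))
    (integrable_const (5 * √((T : ℝ) * K * Real.log ((T : ℝ) * K)) +
      2 * ρ * ((L : ℝ) ^ 2 - 1) / 3)) (by
    filter_upwards [ae_interval_regret B s L (by omega), hslow.ae_abs_sub_le] with μ hreg hdrift
    have h := swap_gain_le (m := fun j => extendRewards μ (s + j))
      (p := fun j a => condRoundProb (exp4S K T) B (s + j) a μ)
      (fun i hi j hj a => by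
        have := hdrift (s + i) (by omega) (s + j) (by omega) a
        push_cast at this
        rwa [add_sub_add_left_eq_sub] at this)
      (fun j a => condRoundProb_nonneg _ _ _ _ _) (fun j => sum_condRoundProb _ _ _ _)
      hreg hL a b
    rw [Finset.sum_congr rfl fun j _ => mul_sub _ _ _, Finset.sum_sub_distrib] at h
    exact h)
  rw [integral_sub' (hint b) (hint a), integral_const, probReal_univ, one_smul] at h
  have h2 := mul_le_mul_of_nonneg_left h (by positivity : (0 : ℝ) ≤ 1 / L)
  have h3 : 1 / (L : ℝ) * (5 * √((T : ℝ) * K * Real.log ((T : ℝ) * K)) +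
      2 * ρ * ((L : ℝ) ^ 2 - 1) / 3) =
      regretTerm 5 T K L + 2 * ρ * ((L : ℝ) ^ 2 - 1) / (3 * L) := by
    rw [regretTerm]; field_simp
  rw [h3, mul_sub] at h2
  linarith

lemma concTerm_nonneg (K L : ℕ) : 0 ≤ concTerm K L := by
  unfold concTerm; positivity

lemma regretTerm_nonneg {C : ℝ} (hC : 0 ≤ C) (T K L : ℕ) : 0 ≤ regretTerm C T K L := by
  unfold regretTerm; positivity

/-- Both conditional payoffs have the same denominator, so the gain is the bound of
`deviation_gain_le` divided by the probability bounded below in `le_recProb`. -/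
lemma condPayoff_update_sub_le [NeZero K] (hL : 1 ≤ L) (hsL : s + L ≤ T)
    (hD : B.temporal i = uniformInterval T s L) {α Δ ρ : ℝ} (hα : 0 < α) (hρ : 0 ≤ ρ)
    (hexp : Explorable B.prior (B.temporal i) α Δ) (hslow : SlowlyMoving B.prior ρ)
    (σ' : Fin K → Fin K) (a : Fin K) :
    (condPayoff (exp4S K T) (Function.update (compliant T K) i σ') B i a : EReal) -
        uniformError 5 T K α Δ ρ L ≤ (condPayoff (exp4S K T) (compliant T K) B i a : EReal) := by
  unfold uniformError
  split_ifs with hpos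
  swap
  · simp
  have hL1 : (1 : ℝ) ≤ L := by exact_mod_cast hL
  have hc := concTerm_nonneg K L
  have hr := regretTerm_nonneg (by norm_num : (0 : ℝ) ≤ 5) T K L
  -- Compliance is the deviation to the identity, so a single formula covers both payoffs.
  have hself : compliant T K = Function.update (compliant T K) i (fun a => a) :=
    (Function.update_eq_self i _).symm
  rw [← EReal.coe_sub, EReal.coe_le_coe_iff, sub_le_iff_le_add]
  conv_rhs => rw [hself]
  rw [condPayoff_update_eq _ hsL hD, condPayoff_update_eq _ hsL hD]
  have hrec := le_recProb hL hsL hD hρ hexp hslow (by linarith) (by linarith) a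
  have hgain := deviation_gain_le hL hsL hslow a (σ' a)
  set P := 1 / (L : ℝ) *
    ∫ μ, ∑ j ∈ Finset.range L, condRoundProb (exp4S K T) B (s + j) a μ ∂B.prior
  set r := regretTerm 5 T K L
  set c := concTerm K L
  set d := 2 * ρ * ((L : ℝ) ^ 2 - 1) / (3 * L) with hd
  have hd0 : 0 ≤ d := by
    refine div_nonneg (mul_nonneg (by linarith) ?_) (by linarith)
    nlinarith
  set D := Δ - ρ * ((L : ℝ) - 1) with hDdef
  have hden : Δ - r - ρ * ((L : ℝ) - 1) - c = D - r - c := by rw [hDdef]; ring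
  rw [hden] at hpos ⊢
  have hD0 : 0 < D := by linarith
  have hP0 : 0 < P := lt_of_lt_of_le (mul_pos hα (div_pos (by linarith) hD0)) hrec
  have hN : 0 ≤ (r + d + c) * D / (α * (D - r - c)) := by positivity
  rw [div_le_iff₀ hP0, add_mul, div_mul_cancel₀ _ hP0.ne']
  refine hgain.trans (add_le_add_right ?_ _)
  -- The concentration term c is nonnegative and only weakens the bound: it enlarges the numerator
  -- and shrinks the effective gap.
  calc r + d ≤ r + d + c := by linarith
    _ = (r + d + c) * D / (α * (D - r - c)) * (α * ((D - r - c) / D)) := by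
        field_simp
    _ ≤ (r + d + c) * D / (α * (D - r - c)) * (α * ((D - r) / D)) := by
        refine mul_le_mul_of_nonneg_left (mul_le_mul_of_nonneg_left ?_ hα.le) hN
        exact div_le_div_of_nonneg_right (by linarith) hD0.le
    _ ≤ _ := mul_le_mul_of_nonneg_left hrec hN

end Agent

/-- With at least two rounds some increment exists, and its norm is nonnegative; with one round the
condition is vacuous and ρ may be negative. -/
lemma SlowlyMoving.nonneg {K T : ℕ} (hT : 2 ≤ T) {B : Belief T K} {ρ : ℝ}
    (h : SlowlyMoving B.prior ρ) : 0 ≤ ρ := by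
  obtain ⟨μ, hμ⟩ := Eventually.exists h
  exact (norm_nonneg _).trans (hμ 0 (by omega))

/-- Exp4.S with parameter `T` is incentive-compatible up to the error `uniformError`. -/
theorem exp4S_isICBayesNash {T K : ℕ} [NeZero K] {α Δ ρ : ℝ} (hα : 0 < α)
    {B : Fin T → Belief T K} {s L : Fin T → ℕ}
    (hexp : ∀ i, Explorable (B i).prior ((B i).temporal i) α Δ)
    (hslow : ∀ i, SlowlyMoving (B i).prior ρ)
    (hD : ∀ i, 1 ≤ L i ∧ s i + L i ≤ T ∧ (B i).temporal i = uniformInterval T (s i) (L i)) :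
    IsICBayesNash (exp4S K T) B (fun i => uniformError 5 T K α Δ ρ (L i)) := by
  intro i σ' a _
  obtain ⟨hL, hsL, hDi⟩ := hD i
  rcases Nat.lt_or_ge T 2 with hT | hT
  · have hL1 : L i = 1 := by omega
    -- For T = 1 the interval has length 1 and every factor multiplying ρ vanishes, so ρ may be
    -- replaced by 0.
    have herr : uniformError 5 T K α Δ ρ (L i) = uniformError 5 T K α Δ 0 (L i) := by
      rw [hL1]; simp [uniformError]
    beta_reduce
    rw [herr]
    exact condPayoff_update_sub_le hL hsL hDi hα le_rfl (hexp i)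
      (Eventually.of_forall fun μ t h => by omega) σ' a
  · exact condPayoff_update_sub_le hL hsL hDi hα ((hslow i).nonneg hT) (hexp i) (hslow i) σ' a

/-! ### Vanishing error -/

section Limit

variable {L : ℕ → ℕ} {ρ : ℕ → ℝ}

lemma tendsto_atTop_of_sqrt_isLittleO
    (hL : (fun T : ℕ => √((T : ℝ) * Real.log T)) =o[atTop] (fun T => (L T : ℝ))) :
    Tendsto (fun T => (L T : ℝ)) atTop atTop := by
  have hlog : Tendsto (fun T : ℕ => √((T : ℝ) * Real.log T)) atTop atTop :=
    Real.tendsto_sqrt_atTop.comp (tendsto_natCast_atTop_atTop.atTop_mul_atTop₀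
      (Real.tendsto_log_atTop.comp tendsto_natCast_atTop_atTop))
  refine tendsto_atTop_mono' _ ?_ hlog
  filter_upwards [hL.bound one_pos] with T hT
  rwa [Real.norm_of_nonneg (Real.sqrt_nonneg _), Real.norm_of_nonneg (Nat.cast_nonneg _),
    one_mul] at hT

lemma tendsto_regretTerm (K : ℕ) [NeZero K]
    (hL : (fun T : ℕ => √((T : ℝ) * Real.log T)) =o[atTop] (fun T => (L T : ℝ))) (C : ℝ) :
    Tendsto (fun T => regretTerm C T K (L T)) atTop (𝓝 0) := by
  have hK : (1 : ℝ) ≤ K := by exact_mod_cast NeZero.pos K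
  have hO : (fun T : ℕ => C * √((T : ℝ) * K * Real.log ((T : ℝ) * K))) =O[atTop]
      fun T : ℕ => √((T : ℝ) * Real.log T) := by
    refine IsBigO.const_mul_left (IsBigO.of_bound √(K * 2) ?_) C
    filter_upwards [eventually_ge_atTop K, eventually_ge_atTop 1] with T hT hT1
    have hT' : (K : ℝ) ≤ T := by exact_mod_cast hT
    -- Once T ≥ K, log(TK) ≤ 2 log T, so the regret term is of order √(T log T) with constant √(2K).
    have hlog : Real.log K ≤ Real.log T := Real.log_le_log (by linarith) hT'
    rw [Real.norm_of_nonneg (Real.sqrt_nonneg _), Real.norm_of_nonneg (Real.sqrt_nonneg _),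
      ← Real.sqrt_mul (by positivity), Real.log_mul (by linarith) (by linarith)]
    refine Real.sqrt_le_sqrt ?_
    have : (T : ℝ) * K * (Real.log T + Real.log K) ≤ T * K * (Real.log T + Real.log T) := by
      gcongr
    linarith
  exact (hO.trans_isLittleO hL).tendsto_div_nhds_zero

lemma tendsto_concTerm (K : ℕ) (hL : Tendsto (fun T => (L T : ℝ)) atTop atTop) :
    Tendsto (fun T => concTerm K (L T)) atTop (𝓝 0) := by
  have h := ((hL.const_div_atTop (2 * Real.log (2 * (K : ℝ)))).sqrt).const_mul 2
  simpa [concTerm] using h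

/-- The error of Exp4.S vanishes when intervals are long and the means move slowly. -/
theorem tendsto_uniformError {K : ℕ} [NeZero K] {α Δ : ℝ} (hα : 0 < α) (hΔ : 0 < Δ) (C : ℝ)
    (hL : (fun T : ℕ => √((T : ℝ) * Real.log T)) =o[atTop] (fun T => (L T : ℝ)))
    (hρ : ρ =o[atTop] (fun T => 1 / (L T : ℝ))) :
    Tendsto (fun T => uniformError C T K α Δ (ρ T) (L T)) atTop (𝓝 (0 : EReal)) := by
  have hLt := tendsto_atTop_of_sqrt_isLittleO hL
  have hr := tendsto_regretTerm K hL C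
  have hc := tendsto_concTerm K hLt
  have hρL : Tendsto (fun T => ρ T * L T) atTop (𝓝 0) := by
    simpa using hρ.tendsto_div_nhds_zero
  have hinv : Tendsto (fun T => (L T : ℝ)⁻¹) atTop (𝓝 0) := tendsto_inv_atTop_zero.comp hLt
  have hne : ∀ᶠ T in atTop, (L T : ℝ) ≠ 0 := hLt.eventually_ne_atTop 0
  have hdrift : Tendsto (fun T => ρ T * ((L T : ℝ) - 1)) atTop (𝓝 0) := by
    have h : Tendsto (fun T => ρ T * L T * (1 - (L T : ℝ)⁻¹)) atTop (𝓝 (0 * (1 - 0))) :=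
      hρL.mul (tendsto_const_nhds.sub hinv)
    rw [zero_mul] at h
    refine h.congr' ?_
    filter_upwards [hne] with T hT
    field_simp
  have hdrift2 : Tendsto (fun T => 2 * ρ T * ((L T : ℝ) ^ 2 - 1) / (3 * L T)) atTop (𝓝 0) := by
    have h : Tendsto (fun T => 2 / 3 * (ρ T * L T) * (1 - (L T : ℝ)⁻¹ ^ 2)) atTop
        (𝓝 (2 / 3 * 0 * (1 - 0 ^ 2))) :=
      (hρL.const_mul _).mul (tendsto_const_nhds.sub (hinv.pow 2))
    rw [mul_zero, zero_mul] at h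
    refine h.congr' ?_
    filter_upwards [hne] with T hT
    field_simp
  have hden : Tendsto (fun T => Δ - regretTerm C T K (L T) - ρ T * ((L T : ℝ) - 1) -
      concTerm K (L T)) atTop (𝓝 Δ) := by
    simpa using ((tendsto_const_nhds (x := Δ)).sub hr).sub hdrift |>.sub hc
  have hreal : Tendsto (fun T => (regretTerm C T K (L T) +
      2 * ρ T * ((L T : ℝ) ^ 2 - 1) / (3 * L T) + concTerm K (L T)) *
        (Δ - ρ T * ((L T : ℝ) - 1)) /
      (α * (Δ - regretTerm C T K (L T) - ρ T * ((L T : ℝ) - 1) - concTerm K (L T))))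
      atTop (𝓝 0) := by
    have h := (((hr.add hdrift2).add hc).mul ((tendsto_const_nhds (x := Δ)).sub hdrift)).div
      (hden.const_mul α) (mul_pos hα hΔ).ne'
    rwa [zero_add, zero_add, zero_mul, zero_div] at h
  have h := (continuous_coe_real_ereal.tendsto 0).comp hreal
  rw [EReal.coe_zero] at h
  refine h.congr' ?_
  -- The effective gap tends to Δ > 0, so the infinite branch of the error is eventually avoided.
  filter_upwards [hden.eventually_const_lt hΔ] with T hT
  simp only [uniformError, Function.comp_apply, if_pos hT]

end Limit

end

theorem mainTheorem3 :
    ∃ C : ℝ, 0 < C ∧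
      (∀ (T K : ℕ) [NeZero K] (α Δ ρ : ℝ), 0 < α → 0 < Δ →
        ∀ (B : Fin T → Belief T K) (s L : Fin T → ℕ),
          (∀ i, Explorable (B i).prior ((B i).temporal i) α Δ) →
          (∀ i, SlowlyMoving (B i).prior ρ) →
          (∀ i, 1 ≤ L i ∧ s i + L i ≤ T ∧ (B i).temporal i = uniformInterval T (s i) (L i)) →
          IsICBayesNash (exp4S K T) B (fun i => uniformError C T K α Δ ρ (L i))) ∧
      (∀ (K : ℕ) [NeZero K] (α Δ : ℝ), 0 < α → 0 < Δ →
        ∀ (L : ℕ → ℕ) (ρ : ℕ → ℝ),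
          (fun T : ℕ => √((T : ℝ) * Real.log T)) =o[atTop] (fun T => (L T : ℝ)) →
          ρ =o[atTop] (fun T => 1 / (L T : ℝ)) →
          Tendsto (fun T => uniformError C T K α Δ (ρ T) (L T)) atTop (𝓝 (0 : EReal))) :=
  ⟨5, by norm_num,
    fun _ _ _ _ _ _ hα _ _ _ _ hexp hslow hD => exp4S_isICBayesNash hα hexp hslow hD,
    fun _ _ _ _ hα hΔ _ _ hL hρ => tendsto_uniformError hα hΔ 5 hL hρ⟩
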